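/- Let $\Bbbk$ be an algebraically closed field of characteristic $0$, let $\mathfrak g$ be a finite-dimensional semisimple Lie algebra over $\Bbbk$, $\mathfrak h$ a Cartan subalgebra, $R$ the root system of $(\mathfrak g,\mathfrak h)$, $\Pi$ a base of $R$, and $\operatorname{rk}(\mathfrak g)=\dim\mathfrak h$. For $S\subseteq\Pi$ put $R^S=R\cap\mathbb ZS$, $R^S_+=R\cap\mathbb NS$, $R^S_-=R^S\setminus R^S_+$; if $S$ is connected (as a nonempty subset of the Dynkin diagram), let $\varepsilon_S$ be the highest root of $R^S$ with respect to $S$. For $Q\subseteq R$ put $\mathfrak g^Q=\sum_{\alpha\in Q}\mathfrak g^\alpha$. Define a set $\mathcal K(S)$ of subsets of $S$ recursively: $\mathcal K(\emptyset)=\emptyset$; if $S_1,\dots,S_r$ are the connected components of $S$, then $\mathcal K(S)=\mathcal K(S_1)\cup\dots\cup\mathcal K(S_r)$; if $S$ is connected, then $\mathcal K(S)=\{S\}\cup\mathcal K(\{\alpha\in S:\langle\alpha,\varepsilon_S^\vee\rangle=0\})$. Every element of $\mathcal K(S)$ is connected. For $S,T\subseteq\Pi$, let $E_{S,T}\subseteq\mathfrak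 h^*$ be the linear span of the $\varepsilon_K$, $K\in\mathcal K(S)\cup\mathcal K(T)$, and let $\mathfrak g_{S,T}=\mathfrak h\oplus\mathfrak g^{R^S_+}\oplus\mathfrak g^{R^T_-}$, a Lie subalgebra of $\mathfrak g$. For a finite-dimensional Lie algebra $\mathfrak a$, let $\chi(\mathfrak a)=\min_{f\in\mathfrak a^*}\dim\{X\in\mathfrak a: f([X,Y])=0\ \text{for all } Y\in\mathfrak a\}$ be its index. Théorème 3.9. For all $S,T\subseteq\Pi$, $$\chi(\mathfrak g_{S,T})\le\operatorname{rk}(\mathfrak g)+\operatorname{card}\mathcal K(S)+\operatorname{card}\mathcal K(T)-2\dim E_{S,T}.$$ -/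

import Mathlib

open Module

noncomputable section

/-! ### Index of a Lie algebra -/

section Index

variable (K A : Type*) [Field K] [LieRing A] [LieAlgebra K A]

/-- The alternating bilinear form `Φ_f (X, Y) = f ⁅X, Y⁆` attached to a linear form `f`. -/
def bracketForm (f : Dual K A) : A →ₗ[K] A →ₗ[K] K :=
  LinearMap.mk₂ K (fun X Y => f ⁅X, Y⁆)
    (fun _ _ _ => by simp) (fun _ _ _ => by simp) (fun _ _ _ => by simp) (fun _ _ _ => by simp)

/-- The index `χ(A)` of a finite-dimensional Lie algebra `A`: the minimum over the linear forms
`f` on `A` of the dimension of the kernel of `Φ_f`. -/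
def lieIndex : ℕ :=
  ⨅ f : Dual K A, finrank K (LinearMap.ker (bracketForm K A f))

end Index

/-! ### Subsets of simple roots and the Kostant cascade

A root is designated by its index `i : ι`; the root itself is `P.root i`. A set of simple roots is
a `Set ι` (contained in the support of a base). -/

section Cascade

variable {ι R M N : Type*} [CommRing R] [AddCommGroup M] [Module R M] [AddCommGroup N] [Module R N]
  (P : RootPairing ι R M N)

/-- `R^S = R ∩ ℤS`. -/
def rootsOf (S : Set ι) : Set ι := {i | P.root i ∈ AddSubgroup.closure (P.root '' S)}

/-- `R_+^S = R ∩ ℕS`. -/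
def posRootsOf (S : Set ι) : Set ι := {i | P.root i ∈ AddSubmonoid.closure (P.root '' S)}

/-- `R_-^S = R^S \ R_+^S`. -/
def negRootsOf (S : Set ι) : Set ι := rootsOf P S \ posRootsOf P S

/-- Two distinct roots are joined when they are not orthogonal. On a set of simple roots this
induces the underlying graph of the Dynkin diagram. -/
def linkGraph : SimpleGraph ι := SimpleGraph.fromRel fun i j => P.pairing i j ≠ 0

/-- `S` is connected (in particular nonempty). -/
def IsConnectedPart (S : Set ι) : Prop := ((linkGraph P).induce S).Connected

/-- `C` is a connected component of `S`. -/
def IsComponentOf (C S : Set ι) : Prop :=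
  ∃ c : ((linkGraph P).induce S).ConnectedComponent, C = Subtype.val '' c.supp

/-- `i` is (the index of) the greatest root `ε_S` of `R^S`, relative to the base `S`: every root
of `R^S` is obtained from it by subtracting an element of `ℕS`. -/
def IsHighestRoot (S : Set ι) (i : ι) : Prop :=
  i ∈ rootsOf P S ∧
    ∀ j ∈ rootsOf P S, P.root i - P.root j ∈ AddSubmonoid.closure (P.root '' S)

/-- `InCascade P S K` means `K ∈ 𝒦(S)`, where `𝒦(∅) = ∅`, `𝒦(S)` is the union of the `𝒦(C)` for
`C` a connected component of `S`, and `𝒦(S) = {S} ∪ 𝒦({α ∈ S | ⟨α, ε_S^∨⟩ = 0})` for `S`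
connected. -/
inductive InCascade : Set ι → Set ι → Prop
  | self {S : Set ι} (hS : IsConnectedPart P S) : InCascade S S
  | orthogonal {S K : Set ι} {e : ι} (hS : IsConnectedPart P S) (he : IsHighestRoot P S e)
      (hK : InCascade {a ∈ S | P.pairing a e = 0} K) : InCascade S K
  | component {S C K : Set ι} (hC : IsComponentOf P C S) (hK : InCascade C K) : InCascade S K

/-- The Kostant cascade `𝒦(S)`. -/
def kostantCascade (S : Set ι) : Set (Set ι) := {K | InCascade P S K}

/-- `E_{S,T}`: the span of the `ε_K` for `K ∈ 𝒦(S) ∪ 𝒦(T)`. -/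
def cascadeSpan (S T : Set ι) : Submodule R M :=
  Submodule.span R
    {x | ∃ K ∈ kostantCascade P S ∪ kostantCascade P T, ∃ i, IsHighestRoot P K i ∧ x = P.root i}

end Cascade

/-! ### The set of roots `R_+^S ∪ R_-^T` is closed -/

section Closed

variable {ι R M N : Type*} [CommRing R]
  [AddCommGroup M] [Module R M] [AddCommGroup N] [Module R N]
  {P : RootPairing ι R M N} [P.IsRootSystem] (b : P.Base)

lemma coord_nat_of_mem {x : M} (hx : x ∈ AddSubmonoid.closure (P.root '' b.support))
    (j : b.support) : ∃ n : ℕ, b.toWeightBasis.repr x j = n := by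
  classical
  induction hx using AddSubmonoid.closure_induction with
  | mem x hx =>
    obtain ⟨i, hi, rfl⟩ := hx
    have := b.toWeightBasis_repr_root ⟨i, hi⟩
    simp only at this
    rw [this, Finsupp.single_apply]
    split_ifs
    · exact ⟨1, by simp⟩
    · exact ⟨0, by simp⟩
  | zero => exact ⟨0, by simp⟩
  | add x y _ _ hx hy =>
    obtain ⟨n, hn⟩ := hx
    obtain ⟨m, hm⟩ := hy
    exact ⟨n + m, by simp [hn, hm]⟩

lemma coord_zero_of_mem {S : Set ι} (hS : S ⊆ b.support) {x : M}
    (hx : x ∈ AddSubgroup.closure (P.root '' S)) (j : b.support) (hj : (j : ι) ∉ S) :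
    b.toWeightBasis.repr x j = 0 := by
  classical
  induction hx using AddSubgroup.closure_induction with
  | mem x hx =>
    obtain ⟨i, hi, rfl⟩ := hx
    have := b.toWeightBasis_repr_root ⟨i, hS hi⟩
    simp only at this
    rw [this, Finsupp.single_apply, if_neg]
    rintro rfl
    exact hj hi
  | zero => simp
  | add x y _ _ hx hy => simp [hx, hy]
  | neg x _ hx => simp [hx]

lemma mem_closure_of_coord {S : Set ι} {x : M}
    (hx : x ∈ AddSubmonoid.closure (P.root '' b.support))
    (h : ∀ j : b.support, (j : ι) ∉ S → b.toWeightBasis.repr x j = 0) :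
    x ∈ AddSubmonoid.closure (P.root '' S) := by
  rw [← b.toWeightBasis.sum_repr x]
  refine sum_mem fun j _ => ?_
  by_cases hj : (j : ι) ∈ S
  · obtain ⟨n, hn⟩ := coord_nat_of_mem b hx j
    rw [hn, Nat.cast_smul_eq_nsmul, b.toWeightBasis_apply]
    exact nsmul_mem (AddSubmonoid.subset_closure (Set.mem_image_of_mem P.root hj)) n
  · rw [h j hj, zero_smul]
    exact zero_mem _

lemma toSubgroup_closure {S : Set ι} {x : M} (hx : x ∈ AddSubmonoid.closure (P.root '' S)) :
    x ∈ AddSubgroup.closure (P.root '' S) :=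
  (AddSubmonoid.closure_le (S := (AddSubgroup.closure (P.root '' S)).toAddSubmonoid)).2
    AddSubgroup.subset_closure hx

lemma closure_of_add_mem [CharZero R] {S : Set ι} (hS : S ⊆ b.support) {x y : M}
    (hx : x ∈ AddSubmonoid.closure (P.root '' b.support))
    (hy : y ∈ AddSubmonoid.closure (P.root '' b.support))
    (h : x + y ∈ AddSubmonoid.closure (P.root '' S)) :
    x ∈ AddSubmonoid.closure (P.root '' S) := by
  refine mem_closure_of_coord b hx fun j hj => ?_
  obtain ⟨n, hn⟩ := coord_nat_of_mem b hx j
  obtain ⟨m, hm⟩ := coord_nat_of_mem b hy j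
  have := coord_zero_of_mem b hS (toSubgroup_closure h) j hj
  rw [map_add, Finsupp.add_apply, hn, hm] at this
  have h' : n + m = 0 := by exact_mod_cast this
  rw [hn, show n = 0 by omega, Nat.cast_zero]

lemma mem_negRootsOf_iff [CharZero R] {T : Set ι} (hT : T ⊆ b.support) (i : ι) :
    i ∈ negRootsOf P T ↔ -P.root i ∈ AddSubmonoid.closure (P.root '' T) := by
  have hsub : AddSubmonoid.closure (P.root '' T) ≤ AddSubmonoid.closure (P.root '' b.support) :=
    AddSubmonoid.closure_mono (Set.image_mono hT)
  constructor
  · rintro ⟨h1, h2⟩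
    rcases b.root_mem_or_neg_mem i with h | h
    · exact (h2 (mem_closure_of_coord b h fun j hj => coord_zero_of_mem b hT h1 j hj)).elim
    · exact mem_closure_of_coord b h fun j hj => coord_zero_of_mem b hT (neg_mem h1) j hj
  · intro h
    refine ⟨neg_mem_iff.mp (toSubgroup_closure h), fun h2 => ?_⟩
    refine P.ne_zero i (b.toWeightBasis.repr.injective ?_)
    ext j
    obtain ⟨n, hn⟩ := coord_nat_of_mem b (hsub h2) j
    obtain ⟨m, hm⟩ := coord_nat_of_mem b (hsub h) j
    have h0 : ((n + m : ℕ) : R) = 0 := by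
      rw [Nat.cast_add, ← hn, ← hm]
      simp
    have h1 : n + m = 0 := by exact_mod_cast h0
    rw [hn, show n = 0 by omega]
    simp

lemma add_mem_posRootsOf_union_negRootsOf [CharZero R] {S T : Set ι} (hS : S ⊆ b.support)
    (hT : T ⊆ b.support) {i j k : ι} (hi : i ∈ posRootsOf P S ∪ negRootsOf P T)
    (hj : j ∈ posRootsOf P S ∪ negRootsOf P T) (hk : P.root k = P.root i + P.root j) :
    k ∈ posRootsOf P S ∪ negRootsOf P T := by
  have hsubS : AddSubmonoid.closure (P.root '' S) ≤ AddSubmonoid.closure (P.root '' b.support) :=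
    AddSubmonoid.closure_mono (Set.image_mono hS)
  have hsubT : AddSubmonoid.closure (P.root '' T) ≤ AddSubmonoid.closure (P.root '' b.support) :=
    AddSubmonoid.closure_mono (Set.image_mono hT)
  have key : ∀ i j : ι, P.root k = P.root i + P.root j →
      P.root i ∈ AddSubmonoid.closure (P.root '' S) →
      -P.root j ∈ AddSubmonoid.closure (P.root '' T) →
      P.root k ∈ AddSubmonoid.closure (P.root '' S) ∨
        -P.root k ∈ AddSubmonoid.closure (P.root '' T) := by
    intro i j hk hi hj
    rcases b.root_mem_or_neg_mem k with h | h
    · exact Or.inl (closure_of_add_mem b hS h (hsubT hj) (by rw [hk]; simpa using hi))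
    · exact Or.inr (closure_of_add_mem b hT h (hsubS hi) (by rw [hk]; simpa using hj))
  simp only [Set.mem_union, mem_negRootsOf_iff b hT] at hi hj ⊢
  change _ ∈ AddSubmonoid.closure (P.root '' S) ∨ _ at hi
  change _ ∈ AddSubmonoid.closure (P.root '' S) ∨ _ at hj
  change _ ∈ AddSubmonoid.closure (P.root '' S) ∨ _
  rcases hi with hi | hi <;> rcases hj with hj | hj
  · exact Or.inl (hk ▸ add_mem hi hj)
  · exact key i j hk hi hj
  · exact key j i (hk.trans (add_comm _ _)) hj hi
  · exact Or.inr (by rw [hk, neg_add]; exact add_mem hi hj)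

end Closed

/-! ### The standard seaweed subalgebra -/

section Seaweed

open LieAlgebra LieAlgebra.IsKilling

variable {K L : Type*} [Field K] [CharZero K] [LieRing L] [LieAlgebra K L]
  [FiniteDimensional K L] [LieAlgebra.IsKilling K L]
  {H : LieSubalgebra K L} [H.IsCartanSubalgebra] [LieModule.IsTriangularizable K H L]

/-- `𝔤^Q`, the sum of the root spaces of the roots belonging to `Q`. -/
def rootSpaceSum (Q : Set H.root) : Submodule K L :=
  ⨆ α ∈ Q, (rootSpace H (α.1 : H → K)).toSubmodule

lemma cartan_eq_rootSpace_zero {K L : Type*} [Field K] [LieRing L] [LieAlgebra K L]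
    [FiniteDimensional K L] {H : LieSubalgebra K L} [H.IsCartanSubalgebra] :
    H.toSubmodule = (rootSpace H (0 : H → K)).toSubmodule := by
  rw [← coe_zeroRootSubalgebra, zeroRootSubalgebra_eq_of_is_cartan]

lemma lie_mem_seaweed {Q : Set H.root}
    (hQ : ∀ i ∈ Q, ∀ j ∈ Q, ∀ k, (rootSystem H).root k = (rootSystem H).root i + (rootSystem H).root j →
      k ∈ Q) {x y : L} (hx : x ∈ H.toSubmodule ⊔ rootSpaceSum Q)
    (hy : y ∈ H.toSubmodule ⊔ rootSpaceSum Q) : ⁅x, y⁆ ∈ H.toSubmodule ⊔ rootSpaceSum Q := by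
  set W := H.toSubmodule ⊔ rootSpaceSum Q with hW
  have hrw : W = ⨆ χ ∈ ({0} ∪ (fun α : H.root => (α.1 : H → K)) '' Q : Set (H → K)),
      (rootSpace H χ).toSubmodule := by
    rw [iSup_union, iSup_singleton, iSup_image, hW, cartan_eq_rootSpace_zero]
    rfl
  have hle : ∀ χ ∈ ({0} ∪ (fun α : H.root => (α.1 : H → K)) '' Q : Set (H → K)),
      (rootSpace H χ).toSubmodule ≤ W := fun χ hχ =>
    hrw ▸ le_iSup₂_of_le (f := fun χ _ => (rootSpace H χ).toSubmodule) χ hχ le_rfl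
  have hadd : ∀ χ ∈ ({0} ∪ (fun α : H.root => (α.1 : H → K)) '' Q : Set (H → K)),
      ∀ ψ ∈ ({0} ∪ (fun α : H.root => (α.1 : H → K)) '' Q : Set (H → K)),
      (rootSpace H (χ + ψ)).toSubmodule ≤ W := by
    rintro χ (rfl | ⟨α, hα, rfl⟩) ψ hψ
    · rw [zero_add]; exact hle _ hψ
    rcases hψ with rfl | ⟨β, hβ, rfl⟩
    · rw [add_zero]; exact hle _ (Or.inr ⟨α, hα, rfl⟩)
    by_cases h0 : ((α.1 : H → K) + (β.1 : H → K)) = 0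
    · simp only [h0]; exact hle _ (Or.inl rfl)
    by_cases hbot : rootSpace H ((α.1 : H → K) + (β.1 : H → K)) = ⊥
    · simp only [hbot]; simp
    let γ : LieModule.Weight K H L := ⟨(α.1 : H → K) + (β.1 : H → K), hbot⟩
    have hγ : γ.IsNonZero := fun h => h0 h
    let k : H.root := ⟨γ, by simpa using hγ⟩
    have hk : k ∈ Q := hQ α hα β hβ k (by ext; simp [k, γ])
    exact hle _ (Or.inr ⟨k, hk, rfl⟩)
  rw [hrw] at hx hy
  induction hx using Submodule.iSup_induction' with
  | zero => simp
  | add x x' _ _ h h' => rw [add_lie]; exact add_mem h h'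
  | mem χ x hx =>
    induction hx using Submodule.iSup_induction' with
    | zero => simp
    | add x x' _ _ h h' => rw [add_lie]; exact add_mem h h'
    | mem hχ x hx =>
      induction hy using Submodule.iSup_induction' with
      | zero => simp
      | add x x' _ _ h h' => rw [lie_add]; exact add_mem h h'
      | mem ψ y hy =>
        induction hy using Submodule.iSup_induction' with
        | zero => simp
        | add x x' _ _ h h' => rw [lie_add]; exact add_mem h h'
        | mem hψ y hy =>
          exact hadd χ hχ ψ hψ (lie_mem_genWeightSpace_of_mem_genWeightSpace hx hy)

/-- The standard seaweed subalgebra `𝔤_{S,T} = 𝔥 ⊕ 𝔤^{R_+^S} ⊕ 𝔤^{R_-^T}`, for sets of simple roots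
`S` and `T`. -/
def seaweed (b : (rootSystem H).Base) (S T : Set H.root) (hS : S ⊆ b.support)
    (hT : T ⊆ b.support) : LieSubalgebra K L where
  toSubmodule := H.toSubmodule ⊔
    (rootSpaceSum (posRootsOf (rootSystem H) S) ⊔ rootSpaceSum (negRootsOf (rootSystem H) T))
  lie_mem' {x y} hx hy := by
    have h : rootSpaceSum (posRootsOf (rootSystem H) S) ⊔
        rootSpaceSum (negRootsOf (rootSystem H) T) =
        rootSpaceSum (posRootsOf (rootSystem H) S ∪ negRootsOf (rootSystem H) T) :=
      iSup_union.symm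
    rw [h] at hx hy ⊢
    exact lie_mem_seaweed
      (fun _ hi _ hj _ hk => add_mem_posRootsOf_union_negRootsOf b hS hT hi hj hk) hx hy

end Seaweed

end

/-! ### Cones of simple roots and properties of a highest root -/

section RootCombinatorics

set_option linter.unusedSectionVars false

open Set

variable {ι k M N : Type*} [Field k] [CharZero k] [AddCommGroup M] [Module k M]
  [AddCommGroup N] [Module k N] {P : RootPairing ι k M N} [P.IsRootSystem] (b : P.Base)

/-! The index is a minimum, so a single well-chosen linear form bounds it. Put Q = R_+^S ∪ R_-^T and
let E ⊆ Q consist of the ε_K for K ∈ 𝒦(S) and the -ε_K for K ∈ 𝒦(T). The forms used are f = ∑_{e ∈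
E} a_e κ(y_e, ·), with κ the Killing form and y_e a root vector of weight -e.

For K ∈ 𝒦(S), the positive roots of R^K not orthogonal to ε_K form a block, and these blocks
partition R_+^S (`exists_inHeisenberg`, `InCascade.eq_of_inHeisenberg`). Each i ≠ ε_K in its block
satisfies ⟨i, ε_K^∨⟩ = 1, so ε_K - i is again a positive root (`exists_partner`), and it is the only
positive root whose sum with i is a cascade root (`summand_eq_of_mem_cascadeRoots`). Within one
sign, Φ_f therefore pairs x_i with the root vector of its partner, while the root vectors of E pair
with 𝔥.

The obstacle is that a positive and a negative root may also add up to an element of E. Let w be the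
negative part of the height: w(i + j) ≤ w(i) + w(j), with equality exactly when i and j have the
same sign. Take a_e = t^(-w(e)) and rescale root vectors by t^w. Mixed terms then carry a positive
power of t, and at t = 0 a square matrix of size |Q ∖ E| + 2d, d = dim E_{S,T}, becomes diagonal and
invertible. It stays invertible for some t ≠ 0 (`exists_sum_smul_finrank_ker_le`). Hence dim ker Φ_f
≤ rk + |Q| - |Q ∖ E| - 2d = rk + |E| - 2d (`lieIndex_add_le`), and |E| ≤ card 𝒦(S) + card 𝒦(T). -/

lemma mem_posRootsOf {S : Set ι} {i : ι} :
    i ∈ posRootsOf P S ↔ P.root i ∈ AddSubmonoid.closure (P.root '' S) := Iff.rfl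

lemma mem_rootsOf {S : Set ι} {i : ι} :
    i ∈ rootsOf P S ↔ P.root i ∈ AddSubgroup.closure (P.root '' S) := Iff.rfl

lemma closure_root_le {S : Set ι} (hS : S ⊆ b.support) {x : M}
    (hx : x ∈ AddSubmonoid.closure (P.root '' S)) :
    x ∈ AddSubmonoid.closure (P.root '' b.support) :=
  AddSubmonoid.closure_mono (image_mono hS) hx

lemma mem_posRootsOf_of_add_mem {S : Set ι} (hS : S ⊆ b.support) {i : ι} {y : M}
    (hi : i ∈ posRootsOf P b.support) (hy : y ∈ AddSubmonoid.closure (P.root '' b.support))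
    (h : P.root i + y ∈ AddSubmonoid.closure (P.root '' S)) : i ∈ posRootsOf P S :=
  mem_posRootsOf.2 (closure_of_add_mem b hS (mem_posRootsOf.1 hi) hy h)

lemma posRootsOf_subset {S : Set ι} (hS : S ⊆ b.support) :
    posRootsOf P S ⊆ posRootsOf P b.support := fun _ hi =>
  mem_posRootsOf.2 (closure_root_le b hS (mem_posRootsOf.1 hi))

lemma eq_zero_of_mem_closure_of_neg_mem {x : M}
    (hx : x ∈ AddSubmonoid.closure (P.root '' b.support))
    (hx' : -x ∈ AddSubmonoid.closure (P.root '' b.support)) : x = 0 := by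
  refine b.toWeightBasis.repr.injective ?_
  ext j
  obtain ⟨n, hn⟩ := coord_nat_of_mem b hx j
  obtain ⟨m, hm⟩ := coord_nat_of_mem b hx' j
  have h0 : ((n + m : ℕ) : k) = 0 := by
    rw [Nat.cast_add, ← hn, ← hm]
    simp
  have h1 : n + m = 0 := by exact_mod_cast h0
  rw [hn, show n = 0 by omega]
  simp

lemma eq_zero_of_add_eq_zero {x y : M}
    (hx : x ∈ AddSubmonoid.closure (P.root '' b.support))
    (hy : y ∈ AddSubmonoid.closure (P.root '' b.support)) (h : x + y = 0) : x = 0 :=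
  eq_zero_of_mem_closure_of_neg_mem b hx (by rwa [neg_eq_of_add_eq_zero_right h])

lemma mem_posRootsOf_or_neg {S : Set ι} (hS : S ⊆ b.support) {i : ι} (hi : i ∈ rootsOf P S) :
    i ∈ posRootsOf P S ∨ -P.root i ∈ AddSubmonoid.closure (P.root '' S) := by
  by_cases h : i ∈ posRootsOf P S
  · exact Or.inl h
  · exact Or.inr ((mem_negRootsOf_iff b hS i).1 ⟨hi, h⟩)

lemma mem_rootsOf_of_mem_posRootsOf {S : Set ι} {i : ι} (hi : i ∈ posRootsOf P S) :
    i ∈ rootsOf P S :=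
  (AddSubmonoid.closure_le (S := (AddSubgroup.closure (P.root '' S)).toAddSubmonoid)).2
    AddSubgroup.subset_closure hi

lemma mem_posRootsOf_of_mem {S : Set ι} {i : ι} (hi : i ∈ S) : i ∈ posRootsOf P S :=
  AddSubmonoid.subset_closure (mem_image_of_mem _ hi)

lemma mem_of_mem_posRootsOf {S : Set ι} (hS : S ⊆ b.support) {i : ι} (hib : i ∈ b.support)
    (hi : i ∈ posRootsOf P S) : i ∈ S := by
  classical
  by_contra h
  have h1 := coord_zero_of_mem b hS (toSubgroup_closure hi) ⟨i, hib⟩ h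
  have h2 := b.toWeightBasis_repr_root ⟨i, hib⟩
  simp only at h2
  rw [h2] at h1
  simp at h1

lemma eq_zero_of_mem_closure_of_disjoint {S T : Set ι} (hS : S ⊆ b.support) (hT : T ⊆ b.support)
    (h : Disjoint S T) {x : M} (hx : x ∈ AddSubmonoid.closure (P.root '' S))
    (hy : x ∈ AddSubmonoid.closure (P.root '' T)) : x = 0 := by
  refine b.toWeightBasis.repr.injective ?_
  ext j
  by_cases hj : (j : ι) ∈ S
  · simpa using coord_zero_of_mem b hT (toSubgroup_closure hy) j (disjoint_left.1 h hj)
  · simpa using coord_zero_of_mem b hS (toSubgroup_closure hx) j hj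

namespace IsHighestRoot

variable {b} {S : Set ι} {e : ι}

/-- Otherwise -ε lies in the cone; maximality against the root -ε puts 2ε there too, which forces ε
= 0. -/
lemma mem_pos (hS : S ⊆ b.support) (he : IsHighestRoot P S e) : e ∈ posRootsOf P S := by
  refine (mem_posRootsOf_or_neg b hS he.1).resolve_right fun h => P.ne_zero e ?_
  have h2 := he.2 (P.reflectionPerm e e) (by
    rw [mem_rootsOf, P.root_reflectionPerm, P.reflection_apply_self]
    exact neg_mem he.1)
  rw [P.root_reflectionPerm, P.reflection_apply_self, sub_neg_eq_add] at h2
  have h3 := eq_zero_of_add_eq_zero b (closure_root_le b hS h2)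
    (closure_root_le b hS (add_mem h h)) (by abel)
  rw [← two_smul k] at h3
  simpa using h3

lemma unique (hS : S ⊆ b.support) {e' : ι} (he : IsHighestRoot P S e)
    (he' : IsHighestRoot P S e') : e = e' := by
  refine P.root.injective (sub_eq_zero.1 ?_)
  exact eq_zero_of_mem_closure_of_neg_mem b (closure_root_le b hS (he.2 _ he'.1))
    (closure_root_le b hS (by rw [neg_sub]; exact he'.2 _ he.1))

variable [P.IsCrystallographic]

lemma reflectionPerm_mem_rootsOf {S : Set ι} {i e : ι} (hi : i ∈ rootsOf P S)
    (he : e ∈ rootsOf P S) : P.reflectionPerm e i ∈ rootsOf P S := by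
  rw [mem_rootsOf, P.root_reflectionPerm, P.reflection_apply_root' ℤ]
  exact sub_mem hi (zsmul_mem he _)

/-- If ⟨i, ε^∨⟩ = -(n + 1), the reflected root i + (n + 1)ε would exceed ε by i + nε, a nonzero
element of the cone. -/
lemma pairingIn_nonneg (hS : S ⊆ b.support) (he : IsHighestRoot P S e) {i : ι}
    (hi : i ∈ posRootsOf P S) : 0 ≤ P.pairingIn ℤ i e := by
  by_contra! h
  have h1 := he.2 _ (reflectionPerm_mem_rootsOf (mem_rootsOf_of_mem_posRootsOf hi) he.1)
  rw [P.root_reflectionPerm, P.reflection_apply_root' ℤ] at h1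
  obtain ⟨n, hn⟩ : ∃ n : ℕ, P.pairingIn ℤ i e = -(n + 1) :=
    ⟨(-P.pairingIn ℤ i e - 1).toNat, by omega⟩
  rw [hn] at h1
  have h2 : P.root i + (n : ℕ) • P.root e ∈ AddSubmonoid.closure (P.root '' S) :=
    add_mem hi (nsmul_mem (he.mem_pos hS) _)
  have h3 := eq_zero_of_add_eq_zero b (closure_root_le b hS h2) (closure_root_le b hS h1)
    (by module)
  exact P.ne_zero i (eq_zero_of_add_eq_zero b
    (closure_root_le b hS (mem_posRootsOf.1 hi))
    (closure_root_le b hS (nsmul_mem (he.mem_pos hS) n)) h3)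

/-- If ⟨i, ε^∨⟩ = n + 2, the opposite of the reflected root is (n + 2)ε - i, which exceeds ε by (ε -
i) + nε; this must vanish, so i = ε. -/
lemma pairingIn_le_one (hS : S ⊆ b.support) (he : IsHighestRoot P S e) {i : ι}
    (hi : i ∈ posRootsOf P S) (hie : i ≠ e) : P.pairingIn ℤ i e ≤ 1 := by
  by_contra! h
  have hr := reflectionPerm_mem_rootsOf (mem_rootsOf_of_mem_posRootsOf hi) he.1
  have h1 := he.2 (P.reflectionPerm (P.reflectionPerm e i) (P.reflectionPerm e i)) (by
    rw [mem_rootsOf, P.root_reflectionPerm, P.reflection_apply_self]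
    exact neg_mem hr)
  rw [P.root_reflectionPerm, P.reflection_apply_self, P.root_reflectionPerm,
    P.reflection_apply_root' ℤ] at h1
  obtain ⟨n, hn⟩ : ∃ n : ℕ, P.pairingIn ℤ i e = n + 2 :=
    ⟨(P.pairingIn ℤ i e - 2).toNat, by omega⟩
  rw [hn] at h1
  have h2 := he.2 i (mem_rootsOf_of_mem_posRootsOf hi)
  have h4 : n • P.root e ∈ AddSubmonoid.closure (P.root '' S) :=
    nsmul_mem (he.mem_pos hS) _
  have h3 := eq_zero_of_add_eq_zero b (closure_root_le b hS (add_mem h2 h4))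
    (closure_root_le b hS h1) (by module)
  exact hie (P.root.injective (sub_eq_zero.1 (eq_zero_of_add_eq_zero b (closure_root_le b hS h2)
    (closure_root_le b hS h4) h3)).symm)

lemma exists_sub (he : IsHighestRoot P S e) {i : ι}
    (hi : i ∈ posRootsOf P S) (h : P.pairingIn ℤ i e = 1) :
    ∃ j ∈ posRootsOf P S, P.root i + P.root j = P.root e := by
  -- Reflecting a root in itself negates it, so this index designates -(i - ε) = ε - i.
  refine ⟨P.reflectionPerm (P.reflectionPerm e i) (P.reflectionPerm e i), ?_, ?_⟩
  · rw [mem_posRootsOf, P.root_reflectionPerm, P.reflection_apply_self, P.root_reflectionPerm,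
      P.reflection_apply_root' ℤ, h, one_smul, neg_sub]
    exact he.2 i (mem_rootsOf_of_mem_posRootsOf hi)
  · rw [P.root_reflectionPerm, P.reflection_apply_self, P.root_reflectionPerm,
      P.reflection_apply_root' ℤ, h, one_smul]
    abel

/-- Both summands pair with ε^∨ to at most 1, and the two values add up to ⟨ε, ε^∨⟩ = 2. -/
lemma summand_mem (hS : S ⊆ b.support) (he : IsHighestRoot P S e) {i j : ι}
    (hi : i ∈ posRootsOf P b.support) (hj : j ∈ posRootsOf P b.support)
    (h : P.root i + P.root j = P.root e) :
    i ∈ posRootsOf P S ∧ P.pairingIn ℤ i e = 1 := by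
  have hmem : P.root i + P.root j ∈ AddSubmonoid.closure (P.root '' S) :=
    by rw [h]; exact mem_posRootsOf.1 (he.mem_pos hS)
  have hiS : i ∈ posRootsOf P S := mem_posRootsOf_of_add_mem b hS hi (mem_posRootsOf.1 hj) hmem
  have hjS : j ∈ posRootsOf P S := 
    mem_posRootsOf_of_add_mem b hS hj (mem_posRootsOf.1 hi)
      (by rwa [add_comm])
  have hie : i ≠ e := by
    rintro rfl
    exact P.ne_zero j (by simpa using h)
  have hje : j ≠ e := by
    rintro rfl
    exact P.ne_zero i (by simpa using h)
  have h1 := he.pairingIn_le_one hS hiS hie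
  have h2 := he.pairingIn_le_one hS hjS hje
  have h3 := RootPairing.pairingIn_eq_add_of_root_eq_add (S := ℤ) (j := e) h.symm
  rw [P.pairingIn_same] at h3
  exact ⟨hiS, by omega⟩

end IsHighestRoot

/-! ### Connected components and supports of positive roots -/

section Components

lemma IsComponentOf.subset {C S : Set ι} (h : IsComponentOf P C S) : C ⊆ S := by
  obtain ⟨c, rfl⟩ := h
  rintro _ ⟨x, -, rfl⟩
  exact x.2

lemma IsComponentOf.eq_of_mem {C C' S : Set ι} (h : IsComponentOf P C S)
    (h' : IsComponentOf P C' S) {i : ι} (hi : i ∈ C) (hi' : i ∈ C') : C = C' := by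
  obtain ⟨c, rfl⟩ := h
  obtain ⟨c', rfl⟩ := h'
  obtain ⟨x, hx, rfl⟩ := hi
  obtain ⟨y, hy, hxy⟩ := hi'
  obtain rfl := Subtype.ext hxy
  rw [SimpleGraph.ConnectedComponent.mem_supp_iff] at hx hy
  rw [← hx, ← hy]

lemma exists_isComponentOf {S : Set ι} {i : ι} (hi : i ∈ S) :
    ∃ C, IsComponentOf P C S ∧ i ∈ C :=
  ⟨_, ⟨((linkGraph P).induce S).connectedComponentMk ⟨i, hi⟩, rfl⟩, ⟨i, hi⟩, rfl, rfl⟩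

lemma IsComponentOf.mem_of_adj {C S : Set ι} (h : IsComponentOf P C S) {i j : ι} (hi : i ∈ C)
    (hj : j ∈ S) (hij : (linkGraph P).Adj i j) : j ∈ C := by
  obtain ⟨c, rfl⟩ := h
  obtain ⟨x, hx, rfl⟩ := hi
  exact ⟨⟨j, hj⟩, c.mem_supp_of_adj_mem_supp hx hij, rfl⟩

lemma IsComponentOf.isConnectedPart {C S : Set ι} (h : IsComponentOf P C S) :
    IsConnectedPart P C := by
  obtain ⟨c, rfl⟩ := h
  have h1 : (((linkGraph P).induce S).induce c.supp).Connected := c.connected_toSimpleGraph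
  let f : ((linkGraph P).induce S).induce c.supp →g
      (linkGraph P).induce (Subtype.val '' c.supp) :=
    { toFun := fun x => ⟨x.1.1, x.1, x.2, rfl⟩
      map_rel' := fun h => h }
  refine h1.map f ?_
  rintro ⟨_, x, hx, rfl⟩
  exact ⟨⟨x, hx⟩, rfl⟩

lemma IsConnectedPart.isComponentOf {S : Set ι} (h : IsConnectedPart P S) :
    IsComponentOf P S S := by
  obtain ⟨x⟩ := h.nonempty
  refine ⟨((linkGraph P).induce S).connectedComponentMk x, ?_⟩
  ext i
  constructor
  · intro hi
    exact ⟨⟨i, hi⟩, SimpleGraph.ConnectedComponent.sound (h.preconnected _ _), rfl⟩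
  · rintro ⟨y, -, rfl⟩
    exact y.2

lemma IsConnectedPart.eq_of_isComponentOf {C S : Set ι} (h : IsConnectedPart P S)
    (hC : IsComponentOf P C S) : C = S := by
  obtain ⟨x⟩ := hC.isConnectedPart.nonempty
  exact hC.eq_of_mem h.isComponentOf x.2 (hC.subset x.2)

lemma linkGraph_adj {i j : ι} : (linkGraph P).Adj i j ↔ i ≠ j ∧ P.pairing i j ≠ 0 := by
  have := P.pairing_eq_zero_iff' (i := j) (j := i)
  rw [linkGraph, SimpleGraph.fromRel_adj]
  tauto

variable [Finite ι] [P.IsCrystallographic]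

lemma coroot'_eq_zero_of_mem_closure {S : Set ι} {j : ι} (h : ∀ i ∈ S, P.pairing i j = 0) {x : M}
    (hx : x ∈ AddSubmonoid.closure (P.root '' S)) : P.coroot' j x = 0 := by
  induction hx using AddSubmonoid.closure_induction with
  | mem x hx =>
    obtain ⟨i, hi, rfl⟩ := hx
    simpa using h i hi
  | zero => simp
  | add x y _ _ hx hy => rw [map_add, hx, hy, add_zero]

/-- Such a difference would have coefficients of both signs in the base. -/
lemma sub_simple_notMem_range {C : Set ι} (hC : C ⊆ b.support) {i j : ι}
    (hi : i ∈ posRootsOf P C) (hj : j ∈ b.support) (hjC : j ∉ C) :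
    P.root i - P.root j ∉ range P.root := by
  rintro ⟨l, hl⟩
  have hdisj : Disjoint C {j} := disjoint_singleton_right.2 hjC
  have hjs : ({j} : Set ι) ⊆ b.support := singleton_subset_iff.2 hj
  rcases b.root_mem_or_neg_mem l with h | h
  · have : j ∈ posRootsOf P C :=
      mem_posRootsOf_of_add_mem b hC (mem_posRootsOf_of_mem (S := (b.support : Set ι)) hj) h
        (by rw [hl, add_sub_cancel]; exact mem_posRootsOf.1 hi)
    exact hjC (mem_of_mem_posRootsOf b hC hj this)
  · have : i ∈ posRootsOf P {j} :=
      mem_posRootsOf_of_add_mem b hjs (posRootsOf_subset b hC hi) h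
        (by rw [hl, neg_sub, add_sub_cancel]; exact AddSubmonoid.subset_closure (mem_image_of_mem _ rfl))
    exact P.ne_zero i (eq_zero_of_mem_closure_of_disjoint b hC hjs hdisj (mem_posRootsOf.1 hi)
      (mem_posRootsOf.1 this))

lemma mem_posRootsOf_support_iff {i : ι} : i ∈ posRootsOf P b.support ↔ b.IsPos i := by
  have key : ∀ l, b.IsPos l → l ∈ posRootsOf P b.support := fun l hl =>
    hl.induction_on_add (fun i hi => mem_posRootsOf_of_mem (S := (b.support : Set ι)) hi)
      fun i j l hl hi hj => by
        rw [mem_posRootsOf, hl]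
        exact add_mem (mem_posRootsOf.1 hi)
          (mem_posRootsOf.1 <| mem_posRootsOf_of_mem (S := (b.support : Set ι)) hj)
  refine ⟨fun hi => (RootPairing.Base.IsPos.or_neg b i).resolve_right fun h => ?_, key i⟩
  have h1 := key _ h
  change P.reflectionPerm i i ∈ _ at h1
  rw [mem_posRootsOf, P.root_reflectionPerm, P.reflection_apply_self] at h1
  exact P.ne_zero i (eq_zero_of_mem_closure_of_neg_mem b (mem_posRootsOf.1 hi) h1)

/-- Build the root by adding simple roots one at a time. If i is supported on a component C and the
next simple root j lies outside C, then j is orthogonal to C, so reflecting i + j in j gives a root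
i - j with coefficients of both signs. -/
lemma exists_component_mem_posRootsOf {S : Set ι} (hS : S ⊆ b.support) {i : ι}
    (hi : i ∈ posRootsOf P S) : ∃ C, IsComponentOf P C S ∧ i ∈ posRootsOf P C := by
  have hpos := (mem_posRootsOf_support_iff b).1 (posRootsOf_subset b hS hi)
  -- Positivity is carried along because it is what lets membership in ℕS descend from a sum to its
  -- summands.
  refine (hpos.induction_on_add (p := fun i => i ∈ posRootsOf P b.support ∧
    (i ∈ posRootsOf P S → ∃ C, IsComponentOf P C S ∧ i ∈ posRootsOf P C)) ?_ ?_).2 hi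
  · intro i hi
    refine ⟨mem_posRootsOf_of_mem (S := (b.support : Set ι)) hi, fun hiS => ?_⟩
    obtain ⟨C, hC, hiC⟩ := exists_isComponentOf (P := P) (mem_of_mem_posRootsOf b hS hi hiS)
    exact ⟨C, hC, mem_posRootsOf_of_mem hiC⟩
  · rintro i j l hl ⟨hi, ih⟩ hj
    have hj' : j ∈ posRootsOf P b.support := mem_posRootsOf_of_mem (S := (b.support : Set ι)) hj
    refine ⟨by rw [mem_posRootsOf, hl]; exact add_mem (mem_posRootsOf.1 hi) (mem_posRootsOf.1 hj'), fun hlS => ?_⟩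
    rw [mem_posRootsOf, hl] at hlS
    obtain ⟨C, hC, hiC⟩ := ih (mem_posRootsOf_of_add_mem b hS hi (mem_posRootsOf.1 hj') hlS)
    have hjS : j ∈ S := mem_of_mem_posRootsOf b hS hj
      (mem_posRootsOf_of_add_mem b hS hj' (mem_posRootsOf.1 hi) (by rwa [add_comm]))
    by_cases hjC : j ∈ C
    · refine ⟨C, hC, ?_⟩
      rw [mem_posRootsOf, hl]
      exact add_mem (mem_posRootsOf.1 hiC) (mem_posRootsOf.1 (mem_posRootsOf_of_mem hjC))
    exfalso
    have h0 : P.coroot' j (P.root i) = 0 := by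
      refine coroot'_eq_zero_of_mem_closure (S := C) (fun c hc => ?_)
        (mem_posRootsOf.1 hiC)
      by_contra h
      refine hjC (hC.mem_of_adj hc hjS (linkGraph_adj.2 ⟨?_, h⟩))
      rintro rfl
      exact hjC hc
    refine sub_simple_notMem_range b (hC.subset.trans hS) hiC hj hjC
      ⟨P.reflectionPerm j l, ?_⟩
    rw [P.root_reflectionPerm, hl, map_add, P.reflection_apply_self, P.reflection_apply, h0]
    simp [sub_eq_add_neg]

end Components

end RootCombinatorics

/-! ### Existence of the highest root of a connected part -/

section HighestRoot

set_option linter.unusedSectionVars false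

open Set

variable {ι k M N : Type*} [Finite ι] [Field k] [CharZero k] [AddCommGroup M] [Module k M]
  [AddCommGroup N] [Module k N] {P : RootPairing ι k M N} [P.IsRootSystem] [P.IsCrystallographic]
  (b : P.Base)

lemma exists_nat_sum_of_mem_closure {S : Set ι} (hS : S ⊆ b.support) {x : M}
    (hx : x ∈ AddSubmonoid.closure (P.root '' S)) :
    ∃ f : b.support → ℕ, x = ∑ c, f c • P.root c ∧ ∀ c : b.support, (c : ι) ∉ S → f c = 0 := by
  choose f hf using coord_nat_of_mem b (closure_root_le b hS hx)
  refine ⟨f, ?_, fun c hc => ?_⟩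
  · conv_lhs => rw [← b.toWeightBasis.sum_repr x]
    refine Finset.sum_congr rfl fun c _ => ?_
    rw [hf, Nat.cast_smul_eq_nsmul, b.toWeightBasis_apply]
  · have := coord_zero_of_mem b hS (toSubgroup_closure hx) c hc
    rw [hf] at this
    exact_mod_cast this

lemma pairingIn_eq_sum {i : ι} {f : b.support → ℕ} (hf : P.root i = ∑ c, f c • P.root c) (j : ι) :
    P.pairingIn ℤ i j = ∑ c, f c * P.pairingIn ℤ c j := by
  have h : (P.pairingIn ℤ i j : k) = ∑ c, (f c : k) * (P.pairingIn ℤ c j : k) := by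
    have h1 := congrArg (P.coroot' j) hf
    rw [map_sum] at h1
    have h2 : ∀ l, P.coroot' j (P.root l) = (P.pairingIn ℤ l j : k) := fun l => by
      rw [P.root_coroot'_eq_pairing, ← P.algebraMap_pairingIn ℤ]
      rfl
    simpa only [map_nsmul, h2, nsmul_eq_mul] using h1
  exact_mod_cast h

variable (P) in
/-- `m` is maximal among the roots of `R^S` for the order whose positive cone is `ℕS`. -/
def IsMaximalRoot (S : Set ι) (m : ι) : Prop :=
  m ∈ posRootsOf P S ∧
    ∀ j ∈ rootsOf P S, P.root j - P.root m ∈ AddSubmonoid.closure (P.root '' S) → j = m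

lemma exists_isMaximalRoot_ge {S : Set ι} (hS : S ⊆ b.support) {i : ι} (hi : i ∈ posRootsOf P S) :
    ∃ m, IsMaximalRoot P S m ∧ P.root m - P.root i ∈ AddSubmonoid.closure (P.root '' S) := by
  -- `r i j` says that i is strictly above j, so `r`-minimal elements are maximal roots.
  let r : ι → ι → Prop := fun i j =>
    i ≠ j ∧ P.root i - P.root j ∈ AddSubmonoid.closure (P.root '' S)
  have : Std.Irrefl r := ⟨fun i h => h.1 rfl⟩
  have : IsTrans ι r := ⟨by
    rintro i j l ⟨hij, h1⟩ ⟨hjl, h2⟩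
    refine ⟨?_, by simpa using add_mem h1 h2⟩
    rintro rfl
    refine hij (P.root.injective (sub_eq_zero.1 ?_))
    exact eq_zero_of_mem_closure_of_neg_mem b (closure_root_le b hS h1)
      (closure_root_le b hS (by rwa [neg_sub]))⟩
  have hwf : WellFounded r := Finite.wellFounded_of_trans_of_irrefl r
  obtain ⟨m, ⟨hm, hmi⟩, hmin⟩ := hwf.has_min
    {j | j ∈ posRootsOf P S ∧ P.root j - P.root i ∈ AddSubmonoid.closure (P.root '' S)}
    ⟨i, hi, by simp⟩
  refine ⟨m, ⟨hm, fun j hj hjm => ?_⟩, hmi⟩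
  by_contra h
  refine hmin j ⟨?_, by simpa using add_mem hjm hmi⟩ ⟨h, hjm⟩
  rw [mem_posRootsOf]
  simpa using add_mem hjm (mem_posRootsOf.1 hm)

namespace IsMaximalRoot

variable {b} {S : Set ι} {m : ι}

/-- A negative pairing would make m + a a root above m. -/
lemma pairingIn_nonneg (hS : S ⊆ b.support) (hm : IsMaximalRoot P S m) {a : ι} (ha : a ∈ S) :
    0 ≤ P.pairingIn ℤ m a := by
  by_contra! h
  have haS := mem_posRootsOf_of_mem (P := P) ha
  obtain ⟨j, hj⟩ := P.root_add_root_mem_of_pairingIn_neg h (fun h => P.ne_zero m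
    (eq_zero_of_add_eq_zero b (closure_root_le b hS (mem_posRootsOf.1 hm.1))
      (closure_root_le b hS (mem_posRootsOf.1 haS)) (by rw [h, neg_add_cancel])))
  have hjm := hm.2 j
    (by rw [mem_rootsOf, hj]; exact add_mem (mem_rootsOf.1 (mem_rootsOf_of_mem_posRootsOf hm.1))
          (mem_rootsOf.1 (mem_rootsOf_of_mem_posRootsOf haS)))
    (by rw [hj, add_sub_cancel_left]; exact mem_posRootsOf.1 haS)
  exact P.ne_zero a (by simpa [hjm] using hj)

/-- Nonvanishing of coefficients propagates along edges of the connected diagram. -/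
lemma coeff_ne_zero (hS : S ⊆ b.support) (hc : IsConnectedPart P S) (hm : IsMaximalRoot P S m)
    {f : b.support → ℕ} (hf : P.root m = ∑ c, f c • P.root c)
    (hf0 : ∀ c : b.support, (c : ι) ∉ S → f c = 0) {a : ι} (ha : a ∈ S) : f ⟨a, hS ha⟩ ≠ 0 := by
  obtain ⟨c, hcf⟩ : ∃ c, f c ≠ 0 := by
    by_contra! h
    exact P.ne_zero m (by simp [hf, h])
  have hcS : (c : ι) ∈ S := by
    by_contra h
    exact hcf (hf0 c h)
  obtain ⟨w⟩ := hc.preconnected ⟨c, hcS⟩ ⟨a, ha⟩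
  suffices H : ∀ (x y : S), ((linkGraph P).induce S).Walk x y → f ⟨x, hS x.2⟩ ≠ 0 →
      f ⟨y, hS y.2⟩ ≠ 0 from H _ _ w hcf
  intro x y w
  induction w with
  | nil => exact id
  | @cons u v w huv p ih =>
    -- If the coefficient at v vanishes, ⟨m, v^∨⟩ is a sum of nonpositive off-diagonal Cartan terms,
    -- strictly negative at the neighbour u: this contradicts dominance of m.
    refine fun hu => ih fun hv => ?_
    have hadj : u.1 ≠ v.1 ∧ P.pairing u v ≠ 0 := linkGraph_adj.1 huv
    have hne : ∀ d : b.support, f d * P.pairingIn ℤ d v ≤ 0 := fun d => by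
      by_cases hd : d = ⟨v, hS v.2⟩
      · rw [hd, hv]
        simp
      · exact mul_nonpos_of_nonneg_of_nonpos (by positivity)
          (b.pairingIn_le_zero_of_ne (fun h => hd (Subtype.ext h)) d.2 (hS v.2))
    have hlt : P.pairingIn ℤ m v < 0 := by
      rw [pairingIn_eq_sum b hf]
      refine Finset.sum_neg' (fun d _ => hne d) ⟨⟨u, hS u.2⟩, Finset.mem_univ _, ?_⟩
      refine lt_of_le_of_ne (hne _) (mul_ne_zero (by exact_mod_cast hu) fun h => hadj.2 ?_)
      rw [← P.algebraMap_pairingIn ℤ, h, map_zero]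
    exact absurd (hm.pairingIn_nonneg hS v.2) (not_le.2 hlt)

/-- Full support of m and dominance of e give ⟨m, e^∨⟩ > 0; if m ≠ e, then m - e is a root, and its
sign makes one of the two non-maximal. -/
lemma unique (hS : S ⊆ b.support) (hc : IsConnectedPart P S) {e : ι} (hm : IsMaximalRoot P S m)
    (he : IsMaximalRoot P S e) : m = e := by
  obtain ⟨f, hf, hf0⟩ := exists_nat_sum_of_mem_closure b hS (mem_posRootsOf.1 hm.1)
  obtain ⟨g, hg, hg0⟩ := exists_nat_sum_of_mem_closure b hS (mem_posRootsOf.1 he.1)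
  have hnn : ∀ c : b.support, (c : ι) ∈ S → 0 ≤ P.pairingIn ℤ c e := fun c hcS => by
    have := he.pairingIn_nonneg hS hcS
    by_contra! h
    rw [P.pairingIn_lt_zero_iff] at h
    omega
  have hpos : 0 < P.pairingIn ℤ m e := by
    obtain ⟨c, hcS, hce⟩ : ∃ c : b.support, (c : ι) ∈ S ∧ P.pairingIn ℤ c e ≠ 0 := by
      by_contra! h
      have h2 := pairingIn_eq_sum b hg e
      rw [P.pairingIn_same, Finset.sum_eq_zero] at h2
      · norm_num at h2
      · intro c _
        by_cases hcS : (c : ι) ∈ S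
        · rw [h c hcS, mul_zero]
        · rw [hg0 c hcS, Nat.cast_zero, zero_mul]
    rw [pairingIn_eq_sum b hf]
    refine Finset.sum_pos' (fun d _ => ?_) ⟨c, Finset.mem_univ _, ?_⟩
    · by_cases hd : (d : ι) ∈ S
      · exact mul_nonneg (by positivity) (hnn d hd)
      · rw [hf0 d hd, Nat.cast_zero, zero_mul]
    · have := coeff_ne_zero hS hc hm hf hf0 hcS
      exact mul_pos (by exact_mod_cast Nat.pos_of_ne_zero this) (lt_of_le_of_ne (hnn c hcS) hce.symm)
  by_contra hne
  obtain ⟨l, hl⟩ := P.root_sub_root_mem_of_pairingIn_pos hpos hne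
  have hlS : l ∈ rootsOf P S := by
    rw [mem_rootsOf, hl]
    exact sub_mem (mem_rootsOf.1 (mem_rootsOf_of_mem_posRootsOf hm.1))
      (mem_rootsOf.1 (mem_rootsOf_of_mem_posRootsOf he.1))
  rcases mem_posRootsOf_or_neg b hS hlS with h | h
  · exact hne (he.2 m (mem_rootsOf_of_mem_posRootsOf hm.1) (hl ▸ mem_posRootsOf.1 h))
  · refine hne (hm.2 e (mem_rootsOf_of_mem_posRootsOf he.1) ?_).symm
    rwa [hl, neg_sub] at h

end IsMaximalRoot

lemma exists_isHighestRoot {S : Set ι} (hS : S ⊆ b.support) (hc : IsConnectedPart P S) :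
    ∃ e, IsHighestRoot P S e := by
  obtain ⟨a⟩ := hc.nonempty
  obtain ⟨e, he, -⟩ := exists_isMaximalRoot_ge b hS (mem_posRootsOf_of_mem (P := P) a.2)
  refine ⟨e, mem_rootsOf_of_mem_posRootsOf he.1, fun j hj => ?_⟩
  rcases mem_posRootsOf_or_neg b hS hj with h | h
  · obtain ⟨m, hm, hmj⟩ := exists_isMaximalRoot_ge b hS h
    rwa [hm.unique hS hc he] at hmj
  · rw [sub_eq_add_neg]
    exact add_mem (mem_posRootsOf.1 he.1) h

end HighestRoot

/-! ### The blocks of the Kostant cascade -/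

section CascadeRoots

set_option linter.unusedSectionVars false

open Set

variable {ι k M N : Type*} [Finite ι] [Field k] [CharZero k] [AddCommGroup M] [Module k M]
  [AddCommGroup N] [Module k N] {P : RootPairing ι k M N} [P.IsRootSystem] [P.IsCrystallographic]
  (b : P.Base)

variable (P) in
/-- The highest roots of the members of the Kostant cascade of `S`. -/
def cascadeRoots (S : Set ι) : Set ι := {e | ∃ K ∈ kostantCascade P S, IsHighestRoot P K e}

lemma InCascade.subset {S K : Set ι} (h : InCascade P S K) : K ⊆ S := by
  induction h with
  | self _ => exact subset_rfl
  | orthogonal _ _ _ ih => exact ih.trans (sep_subset _ _)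
  | component hC _ ih => exact ih.trans hC.subset

/-- Normal form of a derivation: a component of a connected part is that part itself, so successive
passages to components collapse into one. -/
lemma InCascade.exists_component {S K : Set ι} (h : InCascade P S K) :
    ∃ C, IsComponentOf P C S ∧
      (K = C ∨ ∃ e, IsHighestRoot P C e ∧ InCascade P {a ∈ C | P.pairing a e = 0} K) := by
  induction h with
  | self hS => exact ⟨_, hS.isComponentOf, Or.inl rfl⟩
  | orthogonal hS he hK _ => exact ⟨_, hS.isComponentOf, Or.inr ⟨_, he, hK⟩⟩
  | component hC _ ih =>
    obtain ⟨C', hC', h⟩ := ih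
    obtain rfl := hC.isConnectedPart.eq_of_isComponentOf hC'
    exact ⟨_, hC, h⟩

/-- The `i`-th root is a positive root of `R^K` not orthogonal to the highest root of `R^K`. -/
def InHeisenberg (P : RootPairing ι k M N) (K : Set ι) (i : ι) : Prop :=
  i ∈ posRootsOf P K ∧ ∃ e, IsHighestRoot P K e ∧ P.pairing i e ≠ 0

lemma not_inHeisenberg_orthogonal {S K : Set ι} (hS : S ⊆ b.support) {e i : ι}
    (he : IsHighestRoot P S e) (hK : InCascade P {a ∈ S | P.pairing a e = 0} K)
    (hi : InHeisenberg P S i) (hiK : i ∈ posRootsOf P K) : False := by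
  obtain ⟨-, e', he', hne⟩ := hi
  obtain rfl := he.unique hS he'
  refine hne ?_
  rw [← P.root_coroot'_eq_pairing]
  exact coroot'_eq_zero_of_mem_closure (fun c hc => (hK.subset hc).2) (mem_posRootsOf.1 hiK)

/-- The decreasing measure for recursion on the cascade: if all of C were orthogonal to ε, so would
be ε itself. -/
lemma ncard_orthogonal_lt {S C : Set ι} (hS : S ⊆ b.support) (hC : C ⊆ S) {e : ι}
    (he : IsHighestRoot P C e) : {a ∈ C | P.pairing a e = 0}.ncard < S.ncard := by
  refine ncard_lt_ncard (ssubset_of_ssubset_of_subset (ssubset_of_subset_not_subset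
    (sep_subset _ _) fun h => ?_) hC) (toFinite S)
  have h1 := coroot'_eq_zero_of_mem_closure (fun c hc => (h hc).2)
    (mem_posRootsOf.1 (he.mem_pos (hC.trans hS)))
  rw [P.root_coroot'_eq_pairing, P.pairing_same] at h1
  norm_num at h1

/-- Disjointness of the blocks. Distinct components have disjoint supports; inside a component C,
every later member of the cascade is orthogonal to ε_C, hence avoids the block of C. -/
lemma InCascade.eq_of_inHeisenberg {S : Set ι} (hS : S ⊆ b.support) {K L : Set ι}
    (hK : InCascade P S K) (hL : InCascade P S L) {i : ι} (hiK : InHeisenberg P K i)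
    (hiL : InHeisenberg P L i) : K = L := by
  obtain ⟨n, hn⟩ : ∃ n, S.ncard = n := ⟨_, rfl⟩
  induction n using Nat.strong_induction_on generalizing S with
  | _ n ih =>
  obtain ⟨C, hC, hKC⟩ := hK.exists_component
  obtain ⟨C', hC', hLC⟩ := hL.exists_component
  have hCS := hC.subset.trans hS
  have hKC' : K ⊆ C := by
    rcases hKC with rfl | ⟨e, -, h⟩
    · exact subset_rfl
    · exact h.subset.trans (sep_subset _ _)
  have hLC' : L ⊆ C' := by
    rcases hLC with rfl | ⟨e, -, h⟩
    · exact subset_rfl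
    · exact h.subset.trans (sep_subset _ _)
  have hCC' : C = C' := by
    by_contra hne
    refine P.ne_zero i (eq_zero_of_mem_closure_of_disjoint b hCS (hC'.subset.trans hS) ?_
      (AddSubmonoid.closure_mono (image_mono hKC') (mem_posRootsOf.1 hiK.1))
      (AddSubmonoid.closure_mono (image_mono hLC') (mem_posRootsOf.1 hiL.1)))
    exact disjoint_left.2 fun j hj hj' => hne (hC.eq_of_mem hC' hj hj')
  subst hCC'
  rcases hKC with rfl | ⟨e, he, hKe⟩ <;> rcases hLC with rfl | ⟨e', he', hLe⟩
  · rfl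
  · exact (not_inHeisenberg_orthogonal b hCS he' hLe hiK hiL.1).elim
  · exact (not_inHeisenberg_orthogonal b hCS he hKe hiL hiK.1).elim
  · obtain rfl := he.unique hCS he'
    exact ih _ (hn ▸ ncard_orthogonal_lt b hS hC.subset he) ((sep_subset _ _).trans hCS) hKe hLe rfl

/-- The blocks cover. If i is orthogonal to ε_C, then ∑ f_c ⟨c, ε_C^∨⟩ = 0 has nonnegative terms, so
every simple root occurring in i is orthogonal to ε_C and the recursion continues. -/
lemma exists_inHeisenberg {S : Set ι} (hS : S ⊆ b.support) {i : ι} (hi : i ∈ posRootsOf P S) :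
    ∃ K, InCascade P S K ∧ InHeisenberg P K i := by
  obtain ⟨n, hn⟩ : ∃ n, S.ncard = n := ⟨_, rfl⟩
  induction n using Nat.strong_induction_on generalizing S with
  | _ n ih =>
  obtain ⟨C, hC, hiC⟩ := exists_component_mem_posRootsOf b hS hi
  have hCS := hC.subset.trans hS
  obtain ⟨e, he⟩ := exists_isHighestRoot b hCS hC.isConnectedPart
  by_cases h : P.pairing i e = 0
  · have hi' : i ∈ posRootsOf P {a ∈ C | P.pairing a e = 0} := by
      rw [mem_posRootsOf]
      obtain ⟨f, hf, hf0⟩ := exists_nat_sum_of_mem_closure b hCS (mem_posRootsOf.1 hiC)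
      have hnn : ∀ c : b.support, 0 ≤ f c * P.pairingIn ℤ c e := fun c => by
        by_cases hc : (c : ι) ∈ C
        · exact mul_nonneg (by positivity)
            (he.pairingIn_nonneg hCS (mem_posRootsOf_of_mem hc))
        · rw [hf0 c hc, Nat.cast_zero, zero_mul]
      have h0 : P.pairingIn ℤ i e = 0 := by
        rw [← P.algebraMap_pairingIn ℤ] at h
        exact (FaithfulSMul.algebraMap_eq_zero_iff ℤ k).1 h
      rw [pairingIn_eq_sum b hf, Finset.sum_eq_zero_iff_of_nonneg fun c _ => hnn c] at h0
      rw [hf]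
      refine sum_mem fun c _ => ?_
      by_cases hfc : f c = 0
      · rw [hfc, zero_smul]
        exact zero_mem _
      have hcC : (c : ι) ∈ C := by
        by_contra hc
        exact hfc (hf0 c hc)
      have h1 := (mul_eq_zero.1 (h0 c (Finset.mem_univ _))).resolve_left (by exact_mod_cast hfc)
      have h2 : (c : ι) ∈ {a ∈ C | P.pairing a e = 0} :=
        ⟨hcC, by rw [← P.algebraMap_pairingIn ℤ, h1, map_zero]⟩
      exact nsmul_mem (AddSubmonoid.subset_closure (mem_image_of_mem _ h2)) _
    obtain ⟨K, hK, hiK⟩ := ih _ (hn ▸ ncard_orthogonal_lt b hS hC.subset he)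
      ((sep_subset _ _).trans hCS) hi' rfl
    exact ⟨K, .component hC (.orthogonal hC.isConnectedPart he hK), hiK⟩
  · exact ⟨C, .component hC (.self hC.isConnectedPart), hiC, e, he, h⟩

lemma IsHighestRoot.inHeisenberg {K : Set ι} (hK : K ⊆ b.support) {e : ι}
    (he : IsHighestRoot P K e) : InHeisenberg P K e :=
  ⟨he.mem_pos hK, e, he, by rw [P.pairing_same]; norm_num⟩

lemma IsHighestRoot.inHeisenberg_summand {K : Set ι} (hK : K ⊆ b.support) {e i j : ι}
    (he : IsHighestRoot P K e) (hi : i ∈ posRootsOf P b.support) (hj : j ∈ posRootsOf P b.support)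
    (h : P.root i + P.root j = P.root e) : InHeisenberg P K i := by
  obtain ⟨h1, h2⟩ := he.summand_mem hK hi hj h
  exact ⟨h1, e, he, by rw [← P.algebraMap_pairingIn ℤ, h2]; simp⟩

lemma cascadeRoots_subset {S : Set ι} (hS : S ⊆ b.support) :
    cascadeRoots P S ⊆ posRootsOf P S := by
  rintro e ⟨K, hK, he⟩
  exact mem_posRootsOf.2 (AddSubmonoid.closure_mono (image_mono (InCascade.subset hK))
    (mem_posRootsOf.1 (he.mem_pos ((InCascade.subset hK).trans hS))))

/-- Each relation places i in the block of the corresponding K; blocks being disjoint, the two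
cascade roots coincide. -/
lemma summand_eq_of_mem_cascadeRoots {S : Set ι} (hS : S ⊆ b.support) {i j j' e e' : ι}
    (hi : i ∈ posRootsOf P b.support) (hj : j ∈ posRootsOf P b.support)
    (hj' : j' ∈ posRootsOf P b.support) (he : e ∈ cascadeRoots P S) (he' : e' ∈ cascadeRoots P S)
    (h : P.root i + P.root j = P.root e) (h' : P.root i + P.root j' = P.root e') : j = j' := by
  obtain ⟨K, hK, he⟩ := he
  obtain ⟨K', hK', he'⟩ := he'
  have hKS := (InCascade.subset hK).trans hS
  have hKS' := (InCascade.subset hK').trans hS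
  obtain rfl := InCascade.eq_of_inHeisenberg b hS hK hK' (he.inHeisenberg_summand b hKS hi hj h)
    (he'.inHeisenberg_summand b hKS' hi hj' h')
  obtain rfl := he.unique hKS he'
  exact P.root.injective (add_left_cancel (h.trans h'.symm))

/-- A cascade root lies in its own block, so i would equal e and j would vanish. -/
lemma notMem_cascadeRoots_of_add_mem {S : Set ι} (hS : S ⊆ b.support) {i j e : ι}
    (hi : i ∈ posRootsOf P b.support) (hj : j ∈ posRootsOf P b.support)
    (he : e ∈ cascadeRoots P S) (h : P.root i + P.root j = P.root e) : i ∉ cascadeRoots P S := by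
  rintro ⟨K', hK', hi'⟩
  obtain ⟨K, hK, he⟩ := he
  have hKS := (InCascade.subset hK).trans hS
  have hKS' := (InCascade.subset hK').trans hS
  obtain rfl := InCascade.eq_of_inHeisenberg b hS hK hK' (he.inHeisenberg_summand b hKS hi hj h)
    (hi'.inHeisenberg b hKS')
  obtain rfl := he.unique hKS hi'
  exact P.ne_zero j (by simpa using h)

lemma exists_partner {S : Set ι} (hS : S ⊆ b.support) {i : ι} (hi : i ∈ posRootsOf P S)
    (hi' : i ∉ cascadeRoots P S) :
    ∃ j ∈ posRootsOf P S, ∃ e ∈ cascadeRoots P S, P.root i + P.root j = P.root e ∧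
      P.pairing i e = 1 := by
  obtain ⟨K, hK, hiK, e, he, hne⟩ := exists_inHeisenberg b hS hi
  have hKS := hK.subset.trans hS
  have h1 : P.pairingIn ℤ i e = 1 := by
    have h2 := he.pairingIn_nonneg hKS hiK
    have h3 := he.pairingIn_le_one hKS hiK (by rintro rfl; exact hi' ⟨K, hK, he⟩)
    have h4 : P.pairingIn ℤ i e ≠ 0 := fun h => hne (by rw [← P.algebraMap_pairingIn ℤ, h, map_zero])
    omega
  obtain ⟨j, hj, h⟩ := he.exists_sub hiK h1
  refine ⟨j, mem_posRootsOf.2 (AddSubmonoid.closure_mono (image_mono hK.subset)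
    (mem_posRootsOf.1 hj)), e, ⟨K, hK, he⟩, h, ?_⟩
  rw [← P.algebraMap_pairingIn ℤ, h1, map_one]

lemma ncard_cascadeRoots_le {S : Set ι} (hS : S ⊆ b.support) :
    (cascadeRoots P S).ncard ≤ (kostantCascade P S).ncard := by
  choose! K hK he using fun e (h : e ∈ cascadeRoots P S) => h
  refine ncard_le_ncard_of_injOn K hK (fun e h e' h' hee' => ?_) (toFinite _)
  have h1 := he e h
  rw [hee'] at h1
  exact h1.unique ((InCascade.subset (hK e' h')).trans hS) (he e' h')

lemma cascadeSpan_eq (S T : Set ι) :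
    cascadeSpan P S T = Submodule.span k (P.root '' (cascadeRoots P S ∪ cascadeRoots P T)) := by
  rw [cascadeSpan]
  congr 1
  ext x
  simp only [mem_ofPred_eq, mem_image, mem_union, cascadeRoots]
  grind

end CascadeRoots

/-! ### Degeneration of bilinear forms and dual vectors -/

section LinearAlgebra

open Polynomial

variable {k V : Type*} [Field k] [AddCommGroup V] [Module k V]

lemma finrank_ker_add_card_le [FiniteDimensional k V] {κ : Type*} [Fintype κ] [DecidableEq κ] (B : V →ₗ[k] V →ₗ[k] k)
    (u v : κ → V) (h : (Matrix.of fun p q => B (u p) (v q)).det ≠ 0) :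
    finrank k (LinearMap.ker B) + Fintype.card κ ≤ finrank k V := by
  have hli : LinearIndependent k fun p => B (u p) := by
    let r : Dual k V →ₗ[k] κ → k := LinearMap.pi fun q => LinearMap.applyₗ (v q)
    refine LinearIndependent.of_comp r ?_
    exact Matrix.linearIndependent_rows_of_det_ne_zero h
  have h1 : Fintype.card κ ≤ finrank k (LinearMap.range B) := by
    rw [← finrank_span_eq_card hli]
    refine Submodule.finrank_mono (Submodule.span_le.2 ?_)
    rintro _ ⟨p, rfl⟩
    exact ⟨u p, rfl⟩
  have h2 := B.finrank_range_add_finrank_ker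
  omega

/-- If a family of bilinear forms, weighted by powers of a parameter, has in the limit an invertible
diagonal matrix on `(u, v)`, then so does a suitable combination of the forms. -/
lemma exists_sum_smul_finrank_ker_le [FiniteDimensional k V] [Infinite k] {κ ε : Type*} [Fintype κ] [DecidableEq κ]
    [Fintype ε] (B : ε → V →ₗ[k] V →ₗ[k] k) (u v : κ → V) (wu wv : κ → ℕ) (w : ε → ℕ)
    (hle : ∀ p q e, B e (u p) (v q) ≠ 0 → w e ≤ wu p + wv q)
    (hoff : ∀ p q, p ≠ q → ∀ e, w e = wu p + wv q → B e (u p) (v q) = 0)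
    (hdiag : ∀ p, ∃ e, w e = wu p + wv p ∧ B e (u p) (v p) ≠ 0 ∧
      ∀ e' ≠ e, B e' (u p) (v p) = 0) :
    ∃ a : ε → k, finrank k (LinearMap.ker (∑ e, a e • B e)) + Fintype.card κ ≤ finrank k V := by
  -- The matrix of the rescaled form, as a polynomial in the parameter. By `hle`, the subtraction
  -- truncates only where the coefficient is zero.
  let A : Matrix κ κ k[X] := Matrix.of fun p q =>
    ∑ e, C (B e (u p) (v q)) * X ^ (wu p + wv q - w e)
  have hA0 : (A.map (eval 0)).det ≠ 0 := by
    have hd : A.map (eval 0) = Matrix.diagonal fun p => A p p |>.eval 0 := by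
      ext p q
      rcases eq_or_ne p q with rfl | hpq
      · simp
      · rw [Matrix.map_apply, Matrix.diagonal_apply_ne _ hpq]
        simp only [A, Matrix.of_apply, eval_finsetSum, eval_mul, eval_C, eval_pow, eval_X]
        refine Finset.sum_eq_zero fun e _ => ?_
        by_cases h0 : B e (u p) (v q) = 0
        · rw [h0, zero_mul]
        · have h1 := hle p q e h0
          have h2 : w e ≠ wu p + wv q := fun h => h0 (hoff p q hpq e h)
          rw [zero_pow (by omega), mul_zero]
    rw [hd, Matrix.det_diagonal]
    refine Finset.prod_ne_zero_iff.2 fun p _ => ?_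
    obtain ⟨e, he, hne, h⟩ := hdiag p
    simp only [A, Matrix.of_apply, eval_finsetSum, eval_mul, eval_C, eval_pow, eval_X]
    rw [Finset.sum_eq_single e (fun e' _ he' => by rw [h e' he', zero_mul]) (by simp), he,
      Nat.sub_self, pow_zero, mul_one]
    exact hne
  have hev : ∀ t : k, (A.map (eval t)).det = eval t A.det := fun t =>
    (RingHom.map_det (evalRingHom t) A).symm
  -- The factor `X` forces the evaluation point found below to be nonzero, hence invertible.
  have hA : A.det * X ≠ 0 := by
    refine mul_ne_zero (fun h => hA0 ?_) X_ne_zero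
    rw [hev, h, eval_zero]
  obtain ⟨t, ht⟩ : ∃ t, eval t (A.det * X) ≠ 0 := by
    by_contra! h
    exact hA (Polynomial.funext fun t => by rw [h t, eval_zero])
  rw [eval_mul, eval_X, ← hev] at ht
  have ht0 : t ≠ 0 := right_ne_zero_of_mul ht
  refine ⟨fun e => (t ^ w e)⁻¹, finrank_ker_add_card_le _ (fun p => t ^ wu p • u p)
    (fun q => t ^ wv q • v q) ?_⟩
  convert left_ne_zero_of_mul ht using 2
  ext p q
  simp only [A, Matrix.of_apply, Matrix.map_apply, eval_finsetSum, eval_mul, eval_C, eval_pow,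
    eval_X, LinearMap.sum_apply, LinearMap.smul_apply, map_smul, smul_eq_mul]
  rw [Finset.mul_sum, Finset.mul_sum]
  refine Finset.sum_congr rfl fun e _ => ?_
  by_cases h0 : B e (u p) (v q) = 0
  · rw [h0]
    ring
  · obtain ⟨n, hn⟩ := Nat.exists_eq_add_of_le (hle p q e h0)
    have h1 : t ^ wv q * t ^ wu p = t ^ w e * t ^ n := by rw [← pow_add, ← pow_add, ← hn, add_comm]
    rw [hn, Nat.add_sub_cancel_left]
    field_simp
    exact h1

/-- The map x ↦ (r_i x) is onto: a nonzero functional killing its range would be a linear relation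
between the r_i. -/
lemma exists_dual_vectors {n : ℕ} (r : Fin n → Dual k V) (hr : LinearIndependent k r) :
    ∃ h : Fin n → V, ∀ i j, r i (h j) = if i = j then 1 else 0 := by
  have hsurj : Function.Surjective (LinearMap.pi r) := by
    rw [← LinearMap.range_eq_top]
    by_contra hne
    obtain ⟨f, hf, hle⟩ := Submodule.exists_le_ker_of_lt_top _ (lt_top_iff_ne_top.2 hne)
    refine hf ?_
    have h0 : ∑ i, f (Pi.single i 1) • r i = 0 := by
      ext x
      have h1 : f (LinearMap.pi r x) = 0 := hle ⟨x, rfl⟩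
      rw [← Finset.univ_sum_single (LinearMap.pi r x), map_sum] at h1
      rw [LinearMap.sum_apply, LinearMap.zero_apply, ← h1]
      refine Finset.sum_congr rfl fun i _ => ?_
      rw [LinearMap.smul_apply, LinearMap.pi_apply, smul_eq_mul, mul_comm, ← smul_eq_mul,
        ← map_smul, ← Pi.single_smul, smul_eq_mul, mul_one]
    have h2 := Fintype.linearIndependent_iff.1 hr _ h0
    refine LinearMap.pi_ext' fun i => LinearMap.ext_ring ?_
    simpa using h2 i
  choose h hh using fun j => hsurj (Pi.single j 1)
  refine ⟨h, fun i j => ?_⟩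
  have := congrFun (hh j) i
  rw [LinearMap.pi_apply] at this
  rw [this, Pi.single_apply]

end LinearAlgebra

/-! ### Root vectors and the Killing form -/

section RootVectors

set_option linter.unusedSectionVars false

open LieAlgebra LieAlgebra.IsKilling

variable {K L : Type*} [Field K] [CharZero K] [LieRing L] [LieAlgebra K L]
  [FiniteDimensional K L] [LieAlgebra.IsKilling K L]
  {H : LieSubalgebra K L} [H.IsCartanSubalgebra] [LieModule.IsTriangularizable K H L]

variable (H) in
/-- A choice of an `sl₂`-triple for each root. -/
structure RootVectors where
  /-- The root vector attached to a root. -/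
  x : H.root → L
  /-- The opposite root vector. -/
  y : H.root → L
  isSl2Triple (α : H.root) : IsSl2Triple (coroot α.1 : L) (x α) (y α)
  x_mem (α : H.root) : x α ∈ rootSpace H α.1
  y_mem (α : H.root) : y α ∈ rootSpace H (-α.1)

variable (H) in
lemma nonempty_rootVectors : Nonempty (RootVectors H) := by
  have h (α : H.root) : ∃ p : L × L, IsSl2Triple (coroot α.1 : L) p.1 p.2 ∧
      p.1 ∈ rootSpace H α.1 ∧ p.2 ∈ rootSpace H (-α.1) := by
    obtain ⟨h, e, f, ht, he, hf⟩ :=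
      exists_isSl2Triple_of_weight_isNonZero (LieSubalgebra.isNonZero_coe_root α)
    obtain rfl := ht.h_eq_coroot (LieSubalgebra.isNonZero_coe_root α) he hf
    exact ⟨(e, f), ht, he, hf⟩
  choose p hp using h
  exact ⟨fun α => (p α).1, fun α => (p α).2, fun α => (hp α).1, fun α => (hp α).2.1,
    fun α => (hp α).2.2⟩

namespace RootVectors

variable (V : RootVectors H)

lemma exists_smul {α : H.root} {z : L} (hz : z ∈ rootSpace H α.1) : ∃ c : K, c • V.x α = z := by
  obtain ⟨c, hc⟩ := (finrank_eq_one_iff_of_nonzero' (⟨V.x α, V.x_mem α⟩ : rootSpace H α.1)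
    (by simpa using (V.isSl2Triple α).e_ne_zero)).1
    (finrank_rootSpace_eq_one _ (LieSubalgebra.isNonZero_coe_root α)) ⟨z, hz⟩
  exact ⟨c, congrArg Subtype.val hc⟩

lemma killingForm_x_ne_zero {α : H.root} {z : L} (hz : z ∈ rootSpace H (-α.1)) (hz0 : z ≠ 0) :
    killingForm K L z (V.x α) ≠ 0 := by
  intro h
  refine hz0 ?_
  have := mem_ker_killingForm_of_mem_rootSpace_of_forall_rootSpace_neg K L H hz fun w hw => by
    rw [neg_neg] at hw
    obtain ⟨c, rfl⟩ := V.exists_smul hw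
    rw [map_smul, h, smul_zero]
  simpa using this

lemma killingForm_y_x_ne_zero (α : H.root) : killingForm K L (V.y α) (V.x α) ≠ 0 :=
  V.killingForm_x_ne_zero (V.y_mem α) (V.isSl2Triple α).f_ne_zero

lemma killingForm_y_eq_zero {α : H.root} {χ : H → K} {z : L} (hz : z ∈ rootSpace H χ)
    (h : χ ≠ α.1) : killingForm K L (V.y α) z = 0 := by
  refine killingForm_apply_eq_zero_of_mem_rootSpace_of_add_ne_zero K L H (V.y_mem α) hz fun h' => ?_
  refine h ?_
  rw [neg_add_eq_zero] at h'
  exact h'.symm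

lemma root_add_of_killingForm_ne_zero {α β γ : H.root}
    (h : killingForm K L (V.y γ) ⁅V.x α, V.x β⁆ ≠ 0) :
    (rootSystem H).root α + (rootSystem H).root β = (rootSystem H).root γ := by
  by_contra hne
  refine h (V.killingForm_y_eq_zero
    (lie_mem_genWeightSpace_of_mem_genWeightSpace (V.x_mem α) (V.x_mem β)) fun h' => hne ?_)
  ext z
  exact congrFun h' z

/-- By invariance the value is κ([y_γ, x_α], x_β) with [y_γ, x_α] in the root space of -β, so it
suffices that this bracket is nonzero. -/
lemma killingForm_y_lie_ne_zero {α β γ : H.root}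
    (h : (rootSystem H).root α + (rootSystem H).root β = (rootSystem H).root γ)
    (hα : (rootSystem H).pairing α γ = 1) : killingForm K L (V.y γ) ⁅V.x α, V.x β⁆ ≠ 0 := by
  rw [← LieModule.traceForm_apply_lie_apply]
  refine V.killingForm_x_ne_zero ?_ fun h0 => ?_
  · have h1 := lie_mem_genWeightSpace_of_mem_genWeightSpace (V.y_mem γ) (V.x_mem α)
    have h2 : (-γ.1 + α.1 : H → K) = -β.1 := by
      funext z
      have h3 := LinearMap.congr_fun h z
      change (α.1 z : K) + β.1 z = γ.1 z at h3
      change -(γ.1 z : K) + α.1 z = -β.1 z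
      rw [← h3]
      ring
    rwa [h2] at h1
  -- If it vanished, x_α would be primitive of weight -⟨α, γ^∨⟩ = -1 for the triple with x_γ and y_γ
  -- exchanged, but primitive weights are natural numbers.
  · have hp : (V.isSl2Triple γ).symm.HasPrimitiveVectorWith (V.x α) (-1 : K) := by
      refine ⟨(V.isSl2Triple α).e_ne_zero, ?_, h0⟩
      have h1 : ⁅(coroot γ.1 : L), V.x α⁆ = α.1 (coroot γ.1) • V.x α :=
        lie_eq_smul_of_mem_rootSpace (V.x_mem α) (coroot γ.1)
      rw [rootSystem_pairing_apply] at hα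
      rw [neg_lie, h1, hα, neg_smul]
    obtain ⟨n, hn⟩ := hp.exists_nat
    have : ((n + 1 : ℕ) : K) = 0 := by
      rw [Nat.cast_add, ← hn]
      simp
    exact Nat.succ_ne_zero n (by exact_mod_cast this)

lemma killingForm_y_h_x (γ α : H.root) (h : H) :
    killingForm K L (V.y γ) ⁅(h : L), V.x α⁆ = α.1 h * killingForm K L (V.y γ) (V.x α) := by
  have h1 : ⁅(h : L), V.x α⁆ = α.1 h • V.x α := lie_eq_smul_of_mem_rootSpace (V.x_mem α) h
  rw [h1, map_smul, smul_eq_mul]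

lemma killingForm_y_x_of_ne {α γ : H.root} (h : α ≠ γ) :
    killingForm K L (V.y γ) (V.x α) = 0 :=
  V.killingForm_y_eq_zero (V.x_mem α) fun h' => h (Subtype.ext (DFunLike.coe_injective h'))

lemma killingForm_y_h_h (γ : H.root) (h h' : H) :
    killingForm K L (V.y γ) ⁅(h : L), (h' : L)⁆ = 0 := by
  have h1 : ⁅h, h'⁆ = 0 := by
    have : IsLieAbelian H := inferInstance
    exact trivial_lie_zero _ _ _ _
  have h2 : ⁅(h : L), (h' : L)⁆ = 0 := by
    rw [← LieSubalgebra.coe_bracket, h1]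
    rfl
  rw [h2, map_zero]

lemma x_mem_rootSpaceSum {Q : Set H.root} {α : H.root} (hα : α ∈ Q) :
    V.x α ∈ rootSpaceSum Q :=
  Submodule.mem_iSup_of_mem α (Submodule.mem_iSup_of_mem hα (V.x_mem α))

end RootVectors

lemma finrank_rootSpaceSum_le (Q : Set H.root) : finrank K (rootSpaceSum Q) ≤ Q.ncard := by
  obtain ⟨V⟩ := nonempty_rootVectors H
  have hle : rootSpaceSum Q ≤ Submodule.span K (V.x '' Q) := by
    refine iSup₂_le fun α hα z hz => ?_
    obtain ⟨c, rfl⟩ := V.exists_smul hz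
    exact Submodule.smul_mem _ _ (Submodule.subset_span ⟨α, hα, rfl⟩)
  have hfin : (V.x '' Q).Finite := Set.toFinite _
  refine (Submodule.finrank_mono hle).trans (le_trans ?_ (Set.ncard_image_le (f := V.x) Q.toFinite))
  have := hfin.fintype
  rw [Set.ncard_eq_toFinset_card' (V.x '' Q)]
  exact finrank_span_le_card _

lemma finrank_le_of_toSubmodule_eq {g : LieSubalgebra K L} {Q : Set H.root}
    (hg : g.toSubmodule = H.toSubmodule ⊔ rootSpaceSum Q) :
    finrank K g ≤ finrank K H + Q.ncard := by
  have h1 := Submodule.finrank_add_le_finrank_add_finrank H.toSubmodule (rootSpaceSum Q)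
  rw [← hg] at h1
  exact h1.trans (Nat.add_le_add_left (finrank_rootSpaceSum_le Q) _)

lemma lieIndex_le {K A : Type*} [Field K] [LieRing A] [LieAlgebra K A] (f : Dual K A) :
    lieIndex K A ≤ finrank K (LinearMap.ker (bracketForm K A f)) :=
  ciInf_le (OrderBot.bddBelow _) f

end RootVectors

/-! ### The weight separating same-sign sums from mixed sums -/

section Weights

variable {ι k M N : Type*} [Field k] [CharZero k] [AddCommGroup M] [Module k M]
  [AddCommGroup N] [Module k N] {P : RootPairing ι k M N} (b : P.Base)

/-- The negative part of the height of a root. -/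
noncomputable def negHeight (i : ι) : ℕ := (-b.height i).toNat

variable {b} in
lemma negHeight_le {i j e : ι} (h : P.root i + P.root j = P.root e) :
    negHeight b e ≤ negHeight b i + negHeight b j := by
  have := b.height_add h.symm
  simp only [negHeight]
  omega

variable {b} in
lemma isPos_iff_of_negHeight_eq {i j e : ι} (h : P.root i + P.root j = P.root e)
    (hw : negHeight b e = negHeight b i + negHeight b j) : b.IsPos i ↔ b.IsPos j := by
  have := b.height_add h.symm
  have := b.height_ne_zero i
  have := b.height_ne_zero j
  simp only [negHeight] at hw
  rw [b.isPos_iff, b.isPos_iff]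
  omega

variable {b} in
lemma negHeight_eq_of_isPos_iff {i j e : ι} (h : P.root i + P.root j = P.root e)
    (hij : b.IsPos i ↔ b.IsPos j) : negHeight b e = negHeight b i + negHeight b j := by
  have := b.height_add h.symm
  rw [b.isPos_iff, b.isPos_iff] at hij
  simp only [negHeight]
  omega

end Weights

/-! ### The index bound from a system of partners -/

section Index

open LieAlgebra LieAlgebra.IsKilling

variable {K L : Type*} [Field K] [CharZero K] [LieRing L] [LieAlgebra K L]
  [FiniteDimensional K L] [LieAlgebra.IsKilling K L]
  {H : LieSubalgebra K L} [H.IsCartanSubalgebra] [LieModule.IsTriangularizable K H L]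

/-- The three hypotheses on sums of same-sign roots are all that is needed from the cascade: they
make the limit matrix diagonal. Mixed-sign sums need no hypothesis, since the weight `w` removes
them. -/
lemma lieIndex_add_le (b : (rootSystem H).Base) {g : LieSubalgebra K L} {Q E : Set H.root}
    (hg : g.toSubmodule = H.toSubmodule ⊔ rootSpaceSum Q) (hEQ : E ⊆ Q)
    (hpartner : ∀ i ∈ Q \ E, ∃ j ∈ Q, ∃ e ∈ E, (b.IsPos i ↔ b.IsPos j) ∧
      (rootSystem H).root i + (rootSystem H).root j = (rootSystem H).root e ∧
      (rootSystem H).pairing i e = 1)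
    (hunique : ∀ i ∈ Q, ∀ j ∈ Q, ∀ j' ∈ Q, ∀ e ∈ E, ∀ e' ∈ E, (b.IsPos i ↔ b.IsPos j) →
      (b.IsPos i ↔ b.IsPos j') →
      (rootSystem H).root i + (rootSystem H).root j = (rootSystem H).root e →
      (rootSystem H).root i + (rootSystem H).root j' = (rootSystem H).root e' → j = j')
    (hnotMem : ∀ i ∈ Q, ∀ j ∈ Q, ∀ e ∈ E, (b.IsPos i ↔ b.IsPos j) →
      (rootSystem H).root i + (rootSystem H).root j = (rootSystem H).root e → i ∉ E) :
    lieIndex K g + 2 * finrank K (Submodule.span K ((rootSystem H).root '' E)) ≤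
      finrank K H + E.ncard := by
  classical
  obtain ⟨V⟩ := nonempty_rootVectors H
  have hxg : ∀ α ∈ Q, V.x α ∈ g := fun α hα => by
    rw [← LieSubalgebra.mem_toSubmodule, hg]
    exact Submodule.mem_sup_right (V.x_mem_rootSpaceSum hα)
  have hhg : ∀ h : H, (h : L) ∈ g := fun h => by
    rw [← LieSubalgebra.mem_toSubmodule, hg]
    exact Submodule.mem_sup_left h.2
  choose! σ hσQ ε hεE hσpos hσadd hσpair using hpartner
  have hσE : ∀ i ∈ Q \ E, σ i ∉ E := fun i hi =>
    hnotMem _ (hσQ i hi) i hi.1 _ (hεE i hi) (hσpos i hi).symm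
      ((add_comm _ _).trans (hσadd i hi))
  -- Choose roots `r a` of E forming a basis of their span, then dual elements `h a` of the Cartan
  -- subalgebra.
  obtain ⟨d, hd, s, hsE, -, hli⟩ : ∃ d, finrank K (Submodule.span K ((rootSystem H).root '' E)) = d ∧
      ∃ s : Fin d → Dual K H, (∀ a, s a ∈ (rootSystem H).root '' E) ∧
        Submodule.span K (Set.range s) = Submodule.span K ((rootSystem H).root '' E) ∧
        LinearIndependent K s :=
    ⟨_, rfl, Submodule.exists_fun_fin_finrank_span_eq K ((rootSystem H).root '' E)⟩
  rw [hd]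
  choose r hrE hrs using hsE
  obtain rfl : s = fun a => (rootSystem H).root (r a) := funext fun a => (hrs a).symm
  obtain ⟨h, hh⟩ := exists_dual_vectors _ hli
  have hh : ∀ a c, (r a).1 (h c) = if a = c then (1 : K) else 0 := hh
  have hr : Function.Injective r := fun a c hac => hli.injective (by simp only [hac])
  let w : H.root → ℕ := negHeight b
  let φ : H.root → Dual K g := fun e => (killingForm K L (V.y e)).comp g.toSubmodule.subtype
  let B : E → g →ₗ[K] g →ₗ[K] K := fun e => bracketForm K g (φ e)
  -- Index by index, `u` against `v` pairs x_i with x_{σ i}, then h_a with x_{r a}, then x_{r a}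
  -- with h_a; the last two blocks supply 2d.
  let u : ↥(Q \ E) ⊕ (Fin d ⊕ Fin d) → g := Sum.elim (fun i => ⟨V.x i, hxg i i.2.1⟩)
    (Sum.elim (fun a => ⟨h a, hhg _⟩) fun a => ⟨V.x (r a), hxg _ (hEQ (hrE a))⟩)
  let v : ↥(Q \ E) ⊕ (Fin d ⊕ Fin d) → g := Sum.elim (fun i => ⟨V.x (σ i), hxg _ (hσQ i i.2)⟩)
    (Sum.elim (fun a => ⟨V.x (r a), hxg _ (hEQ (hrE a))⟩) fun a => ⟨h a, hhg _⟩)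
  let wu : ↥(Q \ E) ⊕ (Fin d ⊕ Fin d) → ℕ := Sum.elim (fun i => w i)
    (Sum.elim (fun _ => 0) fun a => w (r a))
  let wv : ↥(Q \ E) ⊕ (Fin d ⊕ Fin d) → ℕ := Sum.elim (fun i => w (σ i))
    (Sum.elim (fun a => w (r a)) fun _ => 0)
  have hB : ∀ (e : E) (X Y : g), B e X Y = killingForm K L (V.y e) ⁅(X : L), (Y : L)⁆ :=
    fun _ _ _ => rfl
  have hxh : ∀ (e α : H.root) (z : H), killingForm K L (V.y e) ⁅V.x α, (z : L)⁆ =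
      -(α.1 z * killingForm K L (V.y e) (V.x α)) := fun e α z => by
    rw [← lie_skew, map_neg, V.killingForm_y_h_x]
  have hxx : ∀ e ∈ E, ∀ i ∈ Q, ∀ j ∈ Q, (i ∈ E ∨ j ∈ E) → w e = w i + w j →
      killingForm K L (V.y e) ⁅V.x i, V.x j⁆ = 0 := by
    intro e he i hi j hj hij hw
    by_contra h0
    have h1 := V.root_add_of_killingForm_ne_zero h0
    have h2 := isPos_iff_of_negHeight_eq h1 hw
    rcases hij with hij | hij
    · exact hnotMem i hi j hj e he h2 h1 hij
    · exact hnotMem j hj i hi e he h2.symm ((add_comm _ _).trans h1) hij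
  have hmain := exists_sum_smul_finrank_ker_le B u v wu wv (fun e => w e) ?_ ?_ ?_
  · obtain ⟨a, ha⟩ := hmain
    have h1 : ∑ e, a e • B e = bracketForm K g (∑ e, a e • φ e) := by
      ext X Y
      simp [B, bracketForm]
    rw [h1] at ha
    have h2 := lieIndex_le (∑ e, a e • φ e)
    have h3 := finrank_le_of_toSubmodule_eq hg
    have h4 : Fintype.card (↥(Q \ E) ⊕ (Fin d ⊕ Fin d)) = (Q \ E).ncard + 2 * d := by
      rw [Fintype.card_sum, Fintype.card_sum, Fintype.card_fin, ← Nat.card_eq_fintype_card,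
        Nat.card_coe_set_eq, two_mul]
    -- dim ker + |Q ∖ E| + 2d ≤ dim 𝔤_Q ≤ dim 𝔥 + |Q|, and |Q| = |Q ∖ E| + |E|.
    have h5 := Set.ncard_sdiff_add_ncard_of_subset hEQ (Set.toFinite _)
    omega
  · rintro (i | c | c) (j | c' | c') e hne <;> rw [hB] at hne
    · exact negHeight_le (V.root_add_of_killingForm_ne_zero hne)
    · exact negHeight_le (V.root_add_of_killingForm_ne_zero hne)
    · have hie : (i : H.root) = e := by
        by_contra hie
        refine hne ((hxh _ _ _).trans ?_)
        rw [V.killingForm_y_x_of_ne hie, mul_zero, neg_zero]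
      exact (congrArg w hie).ge
    · have hje : σ j = e := by
        by_contra hje
        refine hne ((V.killingForm_y_h_x _ _ _).trans ?_)
        rw [V.killingForm_y_x_of_ne hje, mul_zero]
      change w e ≤ 0 + w (σ j)
      rw [hje, zero_add]
    · have hje : r c' = e := by
        by_contra hje
        refine hne ((V.killingForm_y_h_x _ _ _).trans ?_)
        rw [V.killingForm_y_x_of_ne hje, mul_zero]
      change w e ≤ 0 + w (r c')
      rw [hje, zero_add]
    · exact absurd (V.killingForm_y_h_h _ _ _) hne
    · exact negHeight_le (V.root_add_of_killingForm_ne_zero hne)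
    · exact negHeight_le (V.root_add_of_killingForm_ne_zero hne)
    · have hie : r c = e := by
        by_contra hie
        refine hne ((hxh _ _ _).trans ?_)
        rw [V.killingForm_y_x_of_ne hie, mul_zero, neg_zero]
      exact (congrArg w hie).ge
  · rintro (i | c | c) (j | c' | c') hne e hw <;> rw [hB]
    -- Equal weights force i and σ j to have the same sign; σ j already has the partner j, so
    -- uniqueness gives i = j.
    · by_contra h0
      have h1 := V.root_add_of_killingForm_ne_zero h0
      have h2 := isPos_iff_of_negHeight_eq h1 hw
      have h3 := hunique _ (hσQ j j.2) i i.2.1 j j.2.1 e e.2 _ (hεE j j.2) h2.symm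
        (hσpos j j.2).symm ((add_comm _ _).trans h1) ((add_comm _ _).trans (hσadd j j.2))
      exact hne (congrArg Sum.inl (Subtype.ext h3))
    · exact hxx e e.2 i i.2.1 _ (hEQ (hrE c')) (Or.inr (hrE c')) hw
    · refine (hxh _ _ _).trans ?_
      rw [V.killingForm_y_x_of_ne (fun h : (i : H.root) = e => i.2.2 (h ▸ e.2)), mul_zero, neg_zero]
    · refine (V.killingForm_y_h_x _ _ _).trans ?_
      rw [V.killingForm_y_x_of_ne (fun h : σ j = e => hσE j j.2 (h ▸ e.2)), mul_zero]
    · refine (V.killingForm_y_h_x _ _ _).trans ?_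
      rw [hh, if_neg (fun h => hne (by rw [h])), zero_mul]
    · exact V.killingForm_y_h_h _ _ _
    · exact hxx e e.2 _ (hEQ (hrE c)) _ (hσQ j j.2) (Or.inl (hrE c)) hw
    · exact hxx e e.2 _ (hEQ (hrE c)) _ (hEQ (hrE c')) (Or.inl (hrE c)) hw
    · refine (hxh _ _ _).trans ?_
      rw [hh, if_neg (fun h => hne (by rw [h])), zero_mul, neg_zero]
  · rintro (i | c | c)
    -- Only the form of ε i sees [x_i, x_{σ i}], because the sum i + σ i determines the cascade
    -- root.
    · refine ⟨⟨ε i, hεE i i.2⟩, negHeight_eq_of_isPos_iff (hσadd i i.2) (hσpos i i.2), ?_, ?_⟩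
      · exact V.killingForm_y_lie_ne_zero (hσadd i i.2) (hσpair i i.2)
      · intro e' he'
        by_contra h0
        have h1 := V.root_add_of_killingForm_ne_zero h0
        exact he' (Subtype.ext ((rootSystem H).root.injective (h1.symm.trans (hσadd i i.2))))
    · refine ⟨⟨r c, hrE c⟩, (zero_add _).symm, ?_, fun e' he' => ?_⟩
      · rw [hB]
        refine ne_of_eq_of_ne (V.killingForm_y_h_x _ _ _) ?_
        rw [hh, if_pos rfl, one_mul]
        exact V.killingForm_y_x_ne_zero _
      · rw [hB]
        refine (V.killingForm_y_h_x _ _ _).trans ?_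
        rw [V.killingForm_y_x_of_ne (fun h => he' (Subtype.ext h.symm)), mul_zero]
    · refine ⟨⟨r c, hrE c⟩, rfl, ?_, fun e' he' => ?_⟩
      · rw [hB]
        refine ne_of_eq_of_ne (hxh _ _ _) ?_
        rw [hh, if_pos rfl, one_mul]
        exact neg_ne_zero.2 (V.killingForm_y_x_ne_zero _)
      · rw [hB]
        refine (hxh _ _ _).trans ?_
        rw [V.killingForm_y_x_of_ne (fun h => he' (Subtype.ext h.symm)), mul_zero, neg_zero]

end Index

/-! ### The two cascades together, with signs -/

section SignedCascadeRoots

set_option linter.unusedSectionVars false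

open Set

variable {ι k M N : Type*} [Finite ι] [Field k] [CharZero k] [AddCommGroup M] [Module k M]
  [AddCommGroup N] [Module k N] {P : RootPairing ι k M N} [P.IsRootSystem] [P.IsCrystallographic]
  (b : P.Base)

variable (P) in
/-- The index of the opposite of the `i`-th root. -/
def oppositeRoot (i : ι) : ι := P.reflectionPerm i i

lemma root_oppositeRoot (i : ι) : P.root (oppositeRoot P i) = -P.root i := by
  rw [oppositeRoot, P.root_reflectionPerm, P.reflection_apply_self]

lemma oppositeRoot_oppositeRoot (i : ι) : oppositeRoot P (oppositeRoot P i) = i :=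
  P.root.injective (by rw [root_oppositeRoot, root_oppositeRoot, neg_neg])

lemma isPos_oppositeRoot_iff (i : ι) : b.IsPos (oppositeRoot P i) ↔ ¬ b.IsPos i :=
  RootPairing.Base.IsPos.neg_iff_not b i

lemma mem_negRootsOf_iff_oppositeRoot {T : Set ι} (hT : T ⊆ b.support) {i : ι} :
    i ∈ negRootsOf P T ↔ oppositeRoot P i ∈ posRootsOf P T := by
  rw [mem_negRootsOf_iff b hT, mem_posRootsOf, root_oppositeRoot]

variable (P) in
/-- The roots `ε_K` for `K ∈ 𝒦(S)` and `-ε_K` for `K ∈ 𝒦(T)`. -/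
def signedCascadeRoots (S T : Set ι) : Set ι :=
  cascadeRoots P S ∪ oppositeRoot P ⁻¹' cascadeRoots P T

variable {b} {S T : Set ι}

lemma isPos_of_mem_posRootsOf (hS : S ⊆ b.support) {i : ι} (hi : i ∈ posRootsOf P S) :
    b.IsPos i :=
  (mem_posRootsOf_support_iff b).1 (posRootsOf_subset b hS hi)

/-- The sign of a root decides whether it comes from S or from T, which reduces each signed
statement to one cascade. -/
lemma mem_of_isPos (hT : T ⊆ b.support) {i : ι} (hi : b.IsPos i) :
    (i ∈ posRootsOf P S ∪ negRootsOf P T → i ∈ posRootsOf P S) ∧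
      (i ∈ signedCascadeRoots P S T → i ∈ cascadeRoots P S) := by
  have key : oppositeRoot P i ∉ posRootsOf P T := fun h =>
    (isPos_oppositeRoot_iff b i).1 (isPos_of_mem_posRootsOf hT h) hi
  refine ⟨fun h => h.resolve_right fun h' => key ?_,
    fun h => h.resolve_right fun h' => key (cascadeRoots_subset b hT h')⟩
  exact (mem_negRootsOf_iff_oppositeRoot b hT).1 h'

lemma mem_of_not_isPos (hS : S ⊆ b.support) (hT : T ⊆ b.support) {i : ι} (hi : ¬ b.IsPos i) :
    (i ∈ posRootsOf P S ∪ negRootsOf P T → oppositeRoot P i ∈ posRootsOf P T) ∧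
      (i ∈ signedCascadeRoots P S T → oppositeRoot P i ∈ cascadeRoots P T) := by
  have key : i ∉ posRootsOf P S := fun h => hi (isPos_of_mem_posRootsOf hS h)
  refine ⟨fun h => ?_, fun h => h.resolve_left fun h' => key (cascadeRoots_subset b hS h')⟩
  exact (mem_negRootsOf_iff_oppositeRoot b hT).1 (h.resolve_left key)

lemma signedCascadeRoots_subset (hS : S ⊆ b.support) (hT : T ⊆ b.support) :
    signedCascadeRoots P S T ⊆ posRootsOf P S ∪ negRootsOf P T :=
  union_subset_union (cascadeRoots_subset b hS) fun _ hi =>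
    (mem_negRootsOf_iff_oppositeRoot b hT).2 (cascadeRoots_subset b hT hi)

lemma isPos_add {i j e : ι} (hij : b.IsPos i ↔ b.IsPos j)
    (h : P.root i + P.root j = P.root e) : b.IsPos e ↔ b.IsPos i := by
  have := b.height_add h.symm
  have := b.height_ne_zero i
  have := b.height_ne_zero j
  rw [b.isPos_iff, b.isPos_iff] at *
  omega

lemma exists_signed_partner (hS : S ⊆ b.support) (hT : T ⊆ b.support) {i : ι}
    (hi : i ∈ (posRootsOf P S ∪ negRootsOf P T) \ signedCascadeRoots P S T) :
    ∃ j ∈ posRootsOf P S ∪ negRootsOf P T, ∃ e ∈ signedCascadeRoots P S T,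
      (b.IsPos i ↔ b.IsPos j) ∧ P.root i + P.root j = P.root e ∧ P.pairing i e = 1 := by
  by_cases hpos : b.IsPos i
  · obtain ⟨j, hj, e, he, h, h1⟩ := exists_partner b hS
      ((mem_of_isPos hT hpos).1 hi.1) fun h => hi.2 (Or.inl h)
    exact ⟨j, Or.inl hj, e, Or.inl he, iff_of_true hpos (isPos_of_mem_posRootsOf hS hj), h, h1⟩
  · obtain ⟨j, hj, e, he, h, h1⟩ := exists_partner b hT
      ((mem_of_not_isPos hS hT hpos).1 hi.1) fun h => hi.2 (Or.inr h)
    -- For a negative root, find the partner of its opposite in the cascade of T and negate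
    -- everything.
    refine ⟨oppositeRoot P j, Or.inr ?_, oppositeRoot P e, Or.inr ?_, iff_of_false hpos ?_, ?_, ?_⟩
    · rwa [mem_negRootsOf_iff_oppositeRoot b hT, oppositeRoot_oppositeRoot]
    · rwa [mem_preimage, oppositeRoot_oppositeRoot]
    · rw [isPos_oppositeRoot_iff, not_not]
      exact isPos_of_mem_posRootsOf hT hj
    · rw [root_oppositeRoot, root_oppositeRoot, ← h, root_oppositeRoot]
      abel
    · rw [oppositeRoot, P.pairing_reflectionPerm_self_left] at h1
      rwa [oppositeRoot, P.pairing_reflectionPerm_self_right]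

lemma signed_summand_eq (hS : S ⊆ b.support) (hT : T ⊆ b.support) {i j j' e e' : ι}
    (he : e ∈ signedCascadeRoots P S T) (he' : e' ∈ signedCascadeRoots P S T)
    (hij : b.IsPos i ↔ b.IsPos j) (hij' : b.IsPos i ↔ b.IsPos j')
    (h : P.root i + P.root j = P.root e) (h' : P.root i + P.root j' = P.root e') : j = j' := by
  have h1 := isPos_add hij h
  have h1' := isPos_add hij' h'
  by_cases hpos : b.IsPos i
  · have hpos' : ∀ l, b.IsPos l → l ∈ posRootsOf P b.support := fun l =>
      (mem_posRootsOf_support_iff b).2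
    exact summand_eq_of_mem_cascadeRoots b hS (hpos' i hpos) (hpos' j (hij.1 hpos))
      (hpos' j' (hij'.1 hpos)) ((mem_of_isPos hT (h1.2 hpos)).2 he)
      ((mem_of_isPos hT (h1'.2 hpos)).2 he') h h'
  · have hop : ∀ l, ¬ b.IsPos l → oppositeRoot P l ∈ posRootsOf P b.support := fun l hl =>
      (mem_posRootsOf_support_iff b).2 ((isPos_oppositeRoot_iff b l).2 hl)
    have h2 := summand_eq_of_mem_cascadeRoots b hT (hop i hpos)
      (hop j (by rwa [← hij])) (hop j' (by rwa [← hij']))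
      ((mem_of_not_isPos hS hT (by rwa [h1])).2 he) ((mem_of_not_isPos hS hT (by rwa [h1'])).2 he')
      (by simp only [root_oppositeRoot, ← h]; abel) (by simp only [root_oppositeRoot, ← h']; abel)
    rw [← oppositeRoot_oppositeRoot (P := P) j, h2, oppositeRoot_oppositeRoot]

lemma notMem_signedCascadeRoots_of_add_mem (hS : S ⊆ b.support) (hT : T ⊆ b.support) {i j e : ι}
    (he : e ∈ signedCascadeRoots P S T) (hij : b.IsPos i ↔ b.IsPos j)
    (h : P.root i + P.root j = P.root e) : i ∉ signedCascadeRoots P S T := by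
  have h1 := isPos_add hij h
  intro hi
  by_cases hpos : b.IsPos i
  · exact notMem_cascadeRoots_of_add_mem b hS ((mem_posRootsOf_support_iff b).2 hpos)
      ((mem_posRootsOf_support_iff b).2 (hij.1 hpos)) ((mem_of_isPos hT (h1.2 hpos)).2 he) h
      ((mem_of_isPos hT hpos).2 hi)
  · have hop : ∀ l, ¬ b.IsPos l → oppositeRoot P l ∈ posRootsOf P b.support := fun l hl =>
      (mem_posRootsOf_support_iff b).2 ((isPos_oppositeRoot_iff b l).2 hl)
    exact notMem_cascadeRoots_of_add_mem b hT (hop i hpos) (hop j (by rwa [← hij]))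
      ((mem_of_not_isPos hS hT (by rwa [h1])).2 he)
      (by simp only [root_oppositeRoot, ← h]; abel) ((mem_of_not_isPos hS hT hpos).2 hi)

lemma ncard_signedCascadeRoots_le (hS : S ⊆ b.support) (hT : T ⊆ b.support) :
    (signedCascadeRoots P S T).ncard ≤ (kostantCascade P S).ncard + (kostantCascade P T).ncard := by
  refine (ncard_union_le _ _).trans (Nat.add_le_add (ncard_cascadeRoots_le b hS)
    (le_trans ?_ (ncard_cascadeRoots_le b hT)))
  refine ncard_le_ncard_of_injOn (oppositeRoot P) (fun i hi => hi) (fun i _ j _ h => ?_)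
    (toFinite _)
  rw [← oppositeRoot_oppositeRoot (P := P) i, h, oppositeRoot_oppositeRoot]

/-- Changing signs of generators does not change a span. -/
lemma cascadeSpan_eq_span_signedCascadeRoots :
    cascadeSpan P S T = Submodule.span k (P.root '' signedCascadeRoots P S T) := by
  rw [cascadeSpan_eq]
  refine le_antisymm (Submodule.span_le.2 ?_) (Submodule.span_le.2 ?_)
  · rintro _ ⟨i, hi | hi, rfl⟩
    · exact Submodule.subset_span ⟨i, Or.inl hi, rfl⟩
    · rw [SetLike.mem_coe, ← neg_mem_iff, ← root_oppositeRoot]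
      refine Submodule.subset_span ⟨_, Or.inr ?_, rfl⟩
      rwa [mem_preimage, oppositeRoot_oppositeRoot]
  · rintro _ ⟨i, hi | hi, rfl⟩
    · exact Submodule.subset_span ⟨i, Or.inl hi, rfl⟩
    · rw [SetLike.mem_coe, ← neg_mem_iff, ← root_oppositeRoot]
      exact Submodule.subset_span ⟨_, Or.inr hi, rfl⟩

end SignedCascadeRoots

/-! ### The index inequality for seaweed subalgebras -/

theorem mainTheorem2 {K L : Type*} [Field K] [IsAlgClosed K] [CharZero K]
    [LieRing L] [LieAlgebra K L] [FiniteDimensional K L] [LieAlgebra.IsSemisimple K L]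
    (H : LieSubalgebra K L) [H.IsCartanSubalgebra]
    (b : (LieAlgebra.IsKilling.rootSystem H).Base)
    (S T : Set H.root) (hS : S ⊆ b.support) (hT : T ⊆ b.support) :
    (lieIndex K (seaweed b S T hS hT) : ℤ) ≤
      Module.finrank K H
        + (kostantCascade (LieAlgebra.IsKilling.rootSystem H) S).ncard
        + (kostantCascade (LieAlgebra.IsKilling.rootSystem H) T).ncard
        - 2 * Module.finrank K (cascadeSpan (LieAlgebra.IsKilling.rootSystem H) S T) := by
  have hg : (seaweed b S T hS hT).toSubmodule = H.toSubmodule ⊔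
      rootSpaceSum (posRootsOf (LieAlgebra.IsKilling.rootSystem H) S ∪
        negRootsOf (LieAlgebra.IsKilling.rootSystem H) T) :=
    congrArg (H.toSubmodule ⊔ ·) iSup_union.symm
  have h1 := lieIndex_add_le b hg (signedCascadeRoots_subset hS hT)
    (fun i hi => exists_signed_partner hS hT hi)
    (fun i _ j _ j' _ e he e' he' => signed_summand_eq hS hT he he')
    (fun i _ j _ e he => notMem_signedCascadeRoots_of_add_mem hS hT he)
  have h2 := ncard_signedCascadeRoots_le hS hT
  rw [← cascadeSpan_eq_span_signedCascadeRoots] at h1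
  omega
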